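/- Let $\mathbb Z^2$ carry its nearest-neighbor bonds $x\sim y$. For real $r>0$ let $B_r=\{x\in\mathbb Z^2:|x|<r\}$ (Euclidean norm), and for real $h$ let $$I_r(h)=\inf\Big\{\mathcal D_{B_r}(\varphi)\ :\ \varphi:\mathbb Z^2\to\mathbb R,\ \varphi=0 \text{ outside } B_r,\ \varphi(0)=h\Big\},\qquad \mathcal D_{B_r}(\varphi)=\sum_{x\sim y}(\varphi(x)-\varphi(y))^2,$$ where the sum is over the unordered nearest-neighbor bonds incident to $B_r$, each counted once. Put $\kappa=\gamma+\frac32\log 2$, where $\gamma$ is Euler's constant. Then there is an absolute constant $C$ such that for every real $r>0$ with $\log r+\kappa\neq0$ there is a real $\varepsilon$, independent of $h$, with $|\varepsilon|\le C/r$ and $$I_r(h)=(2\pi+\varepsilon)\,\frac{h^2}{\log r+\kappa}\qquad\text{for all real } h.$$ In particular, if $r=r(h)$ is any function such that $a\,h/\log h\le r(h)\le b\,h/\log h$ for all sufficiently large $h$, with constants $a>0$ and $b$, then $I_{r(h)}(h)\sim 2\pi h^2/\log h$ as $h\to\infty$; that is, the ratio of the two sides tends to $1$. -/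

import Mathlib

open Filter Asymptotics

/-- The square lattice `ℤ²` with its nearest-neighbour bonds. -/
def squareLattice : SimpleGraph (ℤ × ℤ) where
  Adj x y := |x.1 - y.1| + |x.2 - y.2| = 1
  symm := ⟨fun x y h => by rw [abs_sub_comm y.1, abs_sub_comm y.2]; exact h⟩
  loopless := ⟨fun x h => by simp at h⟩

/-- The discrete ball `B_r` in `ℤ²`: the points of Euclidean norm less than `r`. -/
def discreteBall (r : ℝ) : Set (ℤ × ℤ) :=
  {x | Real.sqrt ((x.1 : ℝ) ^ 2 + (x.2 : ℝ) ^ 2) < r}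

/-- The (unordered) bonds of `ℤ²` with at least one endpoint in `B_r`. -/
def incidentBonds (r : ℝ) : Set (Sym2 (ℤ × ℤ)) :=
  {e | e ∈ squareLattice.edgeSet ∧ ∃ x ∈ e, x ∈ discreteBall r}

theorem discreteBall_finite (r : ℝ) : (discreteBall r).Finite := by
  refine ((Set.finite_Icc (-⌈r⌉) ⌈r⌉).prod (Set.finite_Icc (-⌈r⌉) ⌈r⌉)).subset ?_
  rintro ⟨a, b⟩ h
  simp only [discreteBall, Set.mem_ofPred_eq] at h
  have ha : |(a : ℝ)| < r := lt_of_le_of_lt (Real.abs_le_sqrt (by nlinarith [sq_nonneg (b : ℝ)])) h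
  have hb : |(b : ℝ)| < r := lt_of_le_of_lt (Real.abs_le_sqrt (by nlinarith [sq_nonneg (a : ℝ)])) h
  have hr := Int.le_ceil r
  rw [abs_lt] at ha hb
  simp only [Set.mem_prod, Set.mem_Icc]
  refine ⟨⟨?_, ?_⟩, ?_, ?_⟩ <;> · rify; linarith

/-- The sum defining the Dirichlet energy below is finite. -/
theorem incidentBonds_finite (r : ℝ) : (incidentBonds r).Finite := by
  have hB := discreteBall_finite r
  have hN : (⋃ x ∈ discreteBall r, (fun y => s(x, y)) ''
      (Set.Icc (x.1 - 1) (x.1 + 1) ×ˢ Set.Icc (x.2 - 1) (x.2 + 1))).Finite :=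
    hB.biUnion fun x _ => ((Set.finite_Icc _ _).prod (Set.finite_Icc _ _)).image _
  refine hN.subset ?_
  rintro e ⟨he, x, hxe, hx⟩
  obtain ⟨y, rfl⟩ := hxe
  have h : |x.1 - y.1| + |x.2 - y.2| = 1 := he
  have h1 : |x.1 - y.1| ≤ 1 := by linarith [abs_nonneg (x.2 - y.2)]
  have h2 : |x.2 - y.2| ≤ 1 := by linarith [abs_nonneg (x.1 - y.1)]
  rw [abs_le] at h1 h2
  simp only [Set.mem_iUnion]
  refine ⟨x, hx, y, ?_, rfl⟩
  simp only [Set.mem_prod, Set.mem_Icc]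
  omega

/-- The squared gradient `(φ x - φ y)²` of `φ` across the unordered bond `{x, y}`. -/
def bondEnergy (φ : ℤ × ℤ → ℝ) : Sym2 (ℤ × ℤ) → ℝ :=
  Sym2.lift ⟨fun x y => (φ x - φ y) ^ 2, fun x y => by ring⟩

/-- The Dirichlet energy `𝓓_{B_r}(φ) = ∑_{x ∼ y} (φ x - φ y)²`, each bond incident to `B_r` being
counted once. For `φ` vanishing outside `B_r` all other bonds of `ℤ²` contribute `0`. -/
noncomputable def dirichletEnergy (r : ℝ) (φ : ℤ × ℤ → ℝ) : ℝ :=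
  ∑ᶠ e ∈ incidentBonds r, bondEnergy φ e

/-- `I_r(h)`, the infimum of the Dirichlet energy over the real functions on `ℤ²` that vanish
outside `B_r` and equal `h` at the origin (for `r > 0` there are such functions). -/
noncomputable def minDirichletEnergy (r h : ℝ) : ℝ :=
  sInf {E | ∃ φ : ℤ × ℤ → ℝ, (∀ x, x ∉ discreteBall r → φ x = 0) ∧ φ 0 = h ∧
    E = dirichletEnergy r φ}

/-- `κ = γ + (3/2) log 2`. -/
noncomputable def kappa : ℝ := Real.eulerMascheroniConstant + 3 / 2 * Real.log 2

/-! Let `p` be the Green function of the ball at the origin, scaled so that its lattice Laplacian is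
`-4δ₀` in `B_r`, with `p = 0` outside. By Green's identity every admissible `φ` has gradient pairing
`4 φ(0)` with `p`, so completing the square gives `I_r(h) = 4h²/p(0)` (`minDirichletEnergy_eq`). It
remains to show `p(0) = (2/π)(log r + κ) + O(1/r)` (`exists_green_function`). If `a` is the
potential kernel, with `a(0) = 0` and Laplacian `4δ₀`, then `p + a` is harmonic in `B_r` and equals
`a` on the outer boundary, so the maximum principle transfers the boundary values of `a` to `p(0)`.

The asymptotics `a(x) = (2/π)(log |x| + κ) + O(1/|x|)` come from the Fourier formula `a(x,y) = (2/π)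
∫₀^π (1 - e^{-|y| s(t)} cos(xt)) / sinh s(t) dt`, where `cosh s + cos t = 2`. The integrand splits
into three parts (`potentialIntegrand_eq`). Replacing both `s` and `sinh s` by `t` gives `log |x| +
log π + γ + O(1/|x|)`, by rotating to the real axis and using the exponential integral. The term `∫
(1/sinh s - 1/t)` does not depend on `x` and equals `(3/2) log 2 - log π`. The remaining kernel
error is `O(1/|x|)`: a pointwise bound gives decay in one coordinate, an integration by parts in the
other. -/

open MeasureTheory Topology in
/-- A bounded measurable function is interval integrable. -/
theorem intervalIntegrable_of_abs_le {f : ℝ → ℝ} (hf : Measurable f) {a b C : ℝ} (hab : a ≤ b)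
    (h : ∀ t ∈ Set.Ioc a b, |f t| ≤ C) : IntervalIntegrable f volume a b := by
  rw [intervalIntegrable_iff_integrableOn_Ioc_of_le hab]
  refine Measure.integrableOn_of_bounded (M := C) (by simp) hf.aestronglyMeasurable ?_
  filter_upwards [ae_restrict_mem measurableSet_Ioc] with t ht
  exact h t ht

/-! ### The exponential integral: `Ein x = log x + γ + O(1/x)`. -/

/-- The complementary exponential integral `Ein`. -/
noncomputable def expIntegralEin (x : ℝ) : ℝ := ∫ t in (0 : ℝ)..x, (1 - Real.exp (-t)) / t

theorem abs_one_sub_exp_neg_div_le {t : ℝ} (ht : 0 < t) : |(1 - Real.exp (-t)) / t| ≤ 1 := by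
  have h1 := Real.add_one_le_exp (-t)
  have h2 : Real.exp (-t) ≤ 1 := Real.exp_le_one_iff.2 (by linarith)
  rw [abs_div, abs_of_pos ht, abs_of_nonneg (by linarith), div_le_one ht]
  linarith

theorem intervalIntegrable_one_sub_exp_neg_div {a b : ℝ} (ha : 0 ≤ a) (hab : a ≤ b) :
    IntervalIntegrable (fun t : ℝ => (1 - Real.exp (-t)) / t) MeasureTheory.volume a b :=
  intervalIntegrable_of_abs_le (by fun_prop) hab
    fun _ ht => abs_one_sub_exp_neg_div_le (ha.trans_lt ht.1)

theorem expIntegralEin_sub {a b : ℝ} (ha : 0 < a) (hab : a ≤ b) :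
    expIntegralEin b - expIntegralEin a =
      Real.log b - Real.log a - ∫ t in a..b, Real.exp (-t) / t := by
  have hb : 0 < b := ha.trans_le hab
  rw [expIntegralEin, expIntegralEin, intervalIntegral.integral_interval_sub_left
    (intervalIntegrable_one_sub_exp_neg_div le_rfl hb.le)
    (intervalIntegrable_one_sub_exp_neg_div le_rfl ha.le), ← Real.log_div hb.ne' ha.ne',
    ← integral_inv_of_pos ha hb, ← intervalIntegral.integral_sub]
  · congr 1; ext t; ring
  · exact intervalIntegral.intervalIntegrable_inv
      (fun x hx => by rw [Set.uIcc_of_le hab] at hx; exact (ha.trans_le hx.1).ne')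
      continuousOn_id
  · refine ContinuousOn.intervalIntegrable ?_
    refine ContinuousOn.div (by fun_prop) (by fun_prop) ?_
    intro x hx; rw [Set.uIcc_of_le hab] at hx; exact (ha.trans_le hx.1).ne'

theorem integral_exp_neg_div_mem {a b : ℝ} (ha : 0 < a) (hab : a ≤ b) :
    0 ≤ (∫ t in a..b, Real.exp (-t) / t) ∧ (∫ t in a..b, Real.exp (-t) / t) ≤ 1 / a := by
  constructor
  · refine intervalIntegral.integral_nonneg hab fun t ht => ?_
    have := ha.trans_le ht.1
    positivity
  · have hI : ∫ t in a..b, Real.exp (-t) / a = (Real.exp (-a) - Real.exp (-b)) / a := by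
      rw [intervalIntegral.integral_div]
      congr 1
      have := intervalIntegral.integral_eq_sub_of_hasDerivAt (a := a) (b := b)
        (f := fun t => -Real.exp (-t)) (f' := fun t => Real.exp (-t))
        (fun t _ => ((hasDerivAt_neg t).exp.neg).congr_deriv (by ring))
        (by apply Continuous.intervalIntegrable; fun_prop)
      rw [this]; ring
    calc (∫ t in a..b, Real.exp (-t) / t) ≤ ∫ t in a..b, Real.exp (-t) / a := by
          refine intervalIntegral.integral_mono_on hab ?_ ?_ ?_
          · refine ContinuousOn.intervalIntegrable ?_
            refine ContinuousOn.div (by fun_prop) (by fun_prop) ?_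
            intro x hx; rw [Set.uIcc_of_le hab] at hx; exact (ha.trans_le hx.1).ne'
          · apply Continuous.intervalIntegrable; fun_prop
          · intro t ht
            have := ht.1
            gcongr
      _ ≤ 1 / a := by
          rw [hI]
          have : Real.exp (-a) ≤ 1 := Real.exp_le_one_iff.2 (by linarith)
          have := Real.exp_pos (-b)
          gcongr; linarith

theorem integral_one_sub_exp_neg_mul_div {R b : ℝ} (hR : 0 < R) :
    ∫ t in (0 : ℝ)..b, (1 - Real.exp (-(R * t))) / t = expIntegralEin (R * b) := by
  have := intervalIntegral.integral_comp_mul_left (a := 0) (b := b)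
    (fun t : ℝ => (1 - Real.exp (-t)) / t) hR.ne'
  rw [mul_zero, smul_eq_mul] at this
  rw [eq_inv_mul_iff_mul_eq₀ hR.ne', ← intervalIntegral.integral_const_mul] at this
  rw [expIntegralEin, ← this]
  congr 1; ext t
  field_simp

/-- The integrand is the geometric sum of the powers `(1 - y)^i`, each integrating to `1/(i+1)`. -/
theorem harmonic_eq_integral (N : ℕ) :
    (harmonic N : ℝ) = ∫ y in (0 : ℝ)..1, (1 - (1 - y) ^ N) / y := by
  have h1 : ∫ y in (0 : ℝ)..1, (1 - (1 - y) ^ N) / y =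
      ∫ y in (0 : ℝ)..1, ∑ i ∈ Finset.range N, (1 - y) ^ i := by
    refine intervalIntegral.integral_congr_ae (Eventually.of_forall fun y hy => ?_)
    rw [Set.uIoc_of_le zero_le_one] at hy
    have := geom_sum_mul (1 - y) N
    rw [div_eq_iff hy.1.ne']
    linarith
  rw [h1, intervalIntegral.integral_finsetSum
    (fun i _ => by apply Continuous.intervalIntegrable; fun_prop)]
  rw [harmonic]
  push_cast
  refine Finset.sum_congr rfl fun i _ => ?_
  have := intervalIntegral.integral_comp_sub_left (a := 0) (b := 1) (fun t : ℝ => t ^ i) 1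
  rw [this]
  simp

/-- `0 ≤ e^{-Ny} - (1-y)^N ≤ N y² e^{-(N-1)y}`. -/
theorem exp_neg_mul_sub_one_sub_pow_mem {y : ℝ} (hy : 0 < y) (hy1 : y ≤ 1) (N : ℕ) :
    0 ≤ Real.exp (-((N + 1 : ℕ) * y)) - (1 - y) ^ (N + 1) ∧
      Real.exp (-((N + 1 : ℕ) * y)) - (1 - y) ^ (N + 1) ≤
        (N + 1) * y ^ 2 * Real.exp (-(N * y)) := by
  have e1 : ∀ M : ℕ, Real.exp (-(M * y)) = Real.exp (-y) ^ M := by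
    intro M; rw [← Real.exp_nat_mul]; ring_nf
  rw [e1, e1]
  have h1 : 1 - y ≤ Real.exp (-y) := by linarith [Real.add_one_le_exp (-y)]
  have h0 : 0 ≤ 1 - y := by linarith
  have h2 : Real.exp (-y) - (1 - y) ≤ y ^ 2 := by
    have := Real.abs_exp_sub_one_sub_id_le (x := -y) (by rw [abs_neg, abs_of_pos hy]; exact hy1)
    have := (abs_le.1 this).2
    nlinarith
  refine ⟨sub_nonneg.2 (pow_le_pow_left₀ h0 h1 _), ?_⟩
  -- Factor `a^(N+1) - b^(N+1)` as `(a - b)` times a sum of `N + 1` terms, each at most `e^{-Ny}`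
  -- because `b ≤ a = e^{-y}`.
  rw [← (Commute.all (Real.exp (-y)) (1 - y)).geom_sum₂_mul]
  have hs : ∑ i ∈ Finset.range (N + 1), Real.exp (-y) ^ i * (1 - y) ^ (N + 1 - 1 - i) ≤
      ∑ i ∈ Finset.range (N + 1), Real.exp (-y) ^ N := by
    refine Finset.sum_le_sum fun i hi => ?_
    have hi' : i ≤ N := by simpa [Nat.lt_succ_iff] using hi
    calc Real.exp (-y) ^ i * (1 - y) ^ (N + 1 - 1 - i)
        ≤ Real.exp (-y) ^ i * Real.exp (-y) ^ (N - i) := by simp only [Nat.add_sub_cancel]; gcongr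
      _ = Real.exp (-y) ^ N := by rw [← pow_add]; congr 1; omega
  rw [Finset.sum_const, Finset.card_range, nsmul_eq_mul] at hs
  push_cast at hs
  calc _ ≤ ((N + 1 : ℝ) * Real.exp (-y) ^ N) * y ^ 2 := by
        refine mul_le_mul hs h2 (by linarith) (by positivity)
    _ = _ := by ring

theorem mul_exp_neg_le {c t : ℝ} (hc : 0 < c) : t * Real.exp (-(c * t)) ≤ 1 / c := by
  have h1 := Real.add_one_le_exp (c * t)
  have h2 : Real.exp (c * t) * Real.exp (-(c * t)) = 1 := by rw [← Real.exp_add]; simp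
  have h3 := Real.exp_pos (-(c * t))
  rw [le_div_iff₀ hc]
  nlinarith

theorem integral_exp_neg_mul_le {c b : ℝ} (hc : 0 < c) :
    ∫ t in (0 : ℝ)..b, Real.exp (-(c * t)) ≤ 1 / c := by
  have := intervalIntegral.integral_eq_sub_of_hasDerivAt (a := 0) (b := b)
        (f := fun t => -Real.exp (-(c * t)) / c) (f' := fun t => Real.exp (-(c * t)))
        (fun t _ => by
          have := (((hasDerivAt_id t).const_mul c).neg.exp.neg).div_const c
          refine this.congr_deriv ?_
          simp; field_simp)
        (by apply Continuous.intervalIntegrable; fun_prop)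
  rw [this, ← sub_nonneg]
  have := Real.exp_pos (-(c * b))
  simp only [mul_zero, neg_zero, Real.exp_zero]
  have : 1 / c - (-Real.exp (-(c * b)) / c - -1 / c) = Real.exp (-(c * b)) / c := by ring
  rw [this]; positivity

/-- Rescaled to `[0,1]`, `Ein N` is the integral for the harmonic number with `(1-y)^N` replaced by
`e^{-Ny}`; the difference is `O(1/N)`, and `γ` enters through the harmonic numbers. -/
theorem tendsto_expIntegralEin_sub_log :
    Tendsto (fun N : ℕ => expIntegralEin (N + 2 : ℕ) - Real.log (N + 2 : ℕ)) atTop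
      (nhds Real.eulerMascheroniConstant) := by
  have hd : ∀ N : ℕ, |expIntegralEin (N + 2 : ℕ) - harmonic (N + 2)| ≤ 8 / (N + 1 : ℝ) := by
    intro N
    have hN : (0 : ℝ) < (N + 2 : ℕ) := by positivity
    have h1 := integral_one_sub_exp_neg_mul_div (b := 1) hN
    rw [mul_one] at h1
    have i1 : IntervalIntegrable (fun y : ℝ => (1 - (1 - y) ^ (N + 2)) / y)
        MeasureTheory.volume 0 1 := by
      refine intervalIntegrable_of_abs_le (C := (N + 2 : ℕ)) (by fun_prop) zero_le_one
        fun y hy => ?_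
      have hy0 := hy.1
      have hy1 := hy.2
      have := one_add_mul_le_pow (a := -y) (by linarith) (N + 2)
      have h3 : (1 - y) ^ (N + 2) ≤ 1 := pow_le_one₀ (by linarith) (by linarith)
      rw [abs_div, abs_of_pos hy.1, div_le_iff₀ hy.1, abs_of_nonneg (by linarith)]
      rw [← sub_eq_add_neg] at this
      linarith
    have i2 : IntervalIntegrable (fun y : ℝ => (1 - Real.exp (-((N + 2 : ℕ) * y))) / y)
        MeasureTheory.volume 0 1 := by
      refine intervalIntegrable_of_abs_le (C := (N + 2 : ℕ)) (by fun_prop) zero_le_one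
        fun y hy => ?_
      have hy0 := hy.1
      have h2 := Real.add_one_le_exp (-((N + 2 : ℕ) * y))
      have h3 : Real.exp (-((N + 2 : ℕ) * y)) ≤ 1 :=
        Real.exp_le_one_iff.2 (by have := mul_pos hN hy0; linarith)
      rw [abs_div, abs_of_pos hy.1, div_le_iff₀ hy.1, abs_of_nonneg (by linarith)]
      linarith
    rw [← h1, harmonic_eq_integral, ← intervalIntegral.integral_sub i2 i1, ← Real.norm_eq_abs]
    have hN1 : (0 : ℝ) < (N + 1) / 2 := by positivity
    calc _ ≤ ∫ y in (0 : ℝ)..1, 4 * Real.exp (-((N + 1) / 2 * y)) := by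
          refine intervalIntegral.norm_integral_le_of_norm_le zero_le_one
            (Eventually.of_forall fun y hy => ?_)
            (by apply Continuous.intervalIntegrable; fun_prop)
          obtain ⟨ha, hb⟩ := exp_neg_mul_sub_one_sub_pow_mem hy.1 hy.2 (N + 1)
          have hy0 := hy.1
          have e : (1 - Real.exp (-((N + 2 : ℕ) * y))) / y - (1 - (1 - y) ^ (N + 2)) / y =
              -((Real.exp (-((N + 1 + 1 : ℕ) * y)) - (1 - y) ^ (N + 1 + 1)) / y) := by
            rw [← sub_div, ← neg_div]; congr 1; ring
          rw [e, norm_neg, Real.norm_eq_abs, abs_of_nonneg (by positivity), div_le_iff₀ hy0]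
          refine hb.trans ?_
          -- Split the exponential in halves: one absorbs the factor `y`, the other is integrated.
          have h5 := mul_exp_neg_le (t := y) hN1
          rw [le_div_iff₀ hN1] at h5
          have e2 : Real.exp (-((N + 1 : ℕ) * y)) =
              Real.exp (-((N + 1) / 2 * y)) * Real.exp (-((N + 1) / 2 * y)) := by
            rw [← Real.exp_add]; congr 1; push_cast; ring
          rw [e2]
          have h6 := Real.exp_pos (-((N + 1) / 2 * y))
          set E := Real.exp (-((N + 1) / 2 * y))
          have h7 : ((N + 1 : ℕ) + 1 : ℝ) * (y * E) ≤ 4 := by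
            push_cast
            have : 0 < y * E := by positivity
            have : (0 : ℝ) ≤ N := by positivity
            nlinarith
          calc _ = (((N + 1 : ℕ) + 1 : ℝ) * (y * E)) * (y * E) := by ring
            _ ≤ 4 * (y * E) := by gcongr
            _ = _ := by ring
      _ ≤ 4 * (1 / ((N + 1) / 2)) := by
          rw [intervalIntegral.integral_const_mul]
          gcongr
          exact integral_exp_neg_mul_le hN1
      _ = 8 / (N + 1 : ℝ) := by field_simp; norm_num
  have h0 : Tendsto (fun N : ℕ => expIntegralEin (N + 2 : ℕ) - harmonic (N + 2)) atTop (nhds 0) := by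
    refine squeeze_zero_norm hd ?_
    have := (tendsto_one_div_add_atTop_nhds_zero_nat (𝕜 := ℝ)).const_mul 8
    simpa [div_eq_mul_inv] using this
  have h1 := (tendsto_add_atTop_iff_nat 2).2 Real.tendsto_harmonic_sub_log
  have := h0.add h1
  simp only [zero_add] at this
  refine this.congr fun N => ?_
  ring

/-- Between `x` and a large `N`, `Ein - log` changes by minus the tail integral of `e^{-t}/t`, which
lies in `[0, 1/x]`; let `N → ∞`. -/
theorem abs_expIntegralEin_sub_log_le {x : ℝ} (hx : 0 < x) :
    |expIntegralEin x - Real.log x - Real.eulerMascheroniConstant| ≤ 1 / x := by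
  have hev : ∀ᶠ N : ℕ in atTop, x ≤ (N + 2 : ℕ) := by
    filter_upwards [eventually_ge_atTop ⌈x⌉₊] with N hN
    have : x ≤ N := (Nat.le_ceil x).trans (by exact_mod_cast hN)
    push_cast; linarith
  have h1 := le_of_tendsto tendsto_expIntegralEin_sub_log
    (b := expIntegralEin x - Real.log x) (by
      filter_upwards [hev] with N hN
      have := expIntegralEin_sub hx hN
      have := (integral_exp_neg_div_mem hx hN).1
      linarith)
  have h2 := ge_of_tendsto tendsto_expIntegralEin_sub_log
    (b := expIntegralEin x - Real.log x - 1 / x) (by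
      filter_upwards [hev] with N hN
      have := expIntegralEin_sub hx hN
      have := (integral_exp_neg_div_mem hx hN).2
      linarith)
  rw [abs_le]
  constructor <;> linarith [one_div_pos.2 hx]

/-! ### The truncated logarithmic integral at complex arguments. -/

theorem abs_one_sub_exp_mul_cos_le (u v : ℝ) :
    |1 - Real.exp u * Real.cos v| ≤ (|u| + |v|) * Real.exp |u| := by
  have h1 : |1 - Real.exp u| ≤ |u| * Real.exp |u| := by
    rcases le_total 0 u with hu | hu
    · rw [abs_of_nonneg hu, abs_sub_comm, abs_of_nonneg (by linarith [Real.add_one_le_exp u])]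
      have h2 := Real.add_one_le_exp (-u)
      have h3 : Real.exp u * Real.exp (-u) = 1 := by rw [← Real.exp_add]; simp
      nlinarith [Real.exp_pos u]
    · have h2 := Real.add_one_le_exp u
      have h3 : Real.exp u ≤ 1 := Real.exp_le_one_iff.2 hu
      have h4 : 1 ≤ Real.exp |u| := Real.one_le_exp (abs_nonneg u)
      rw [abs_of_nonneg (by linarith)]
      have : |u| = -u := abs_of_nonpos hu
      nlinarith [abs_nonneg u]
  have h5 : |1 - Real.cos v| ≤ |v| := by
    have := Real.abs_cos_sub_cos_le 0 v
    simpa using this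
  have h6 : Real.exp u ≤ Real.exp |u| := Real.exp_le_exp.2 (le_abs_self u)
  calc |1 - Real.exp u * Real.cos v|
      = |(1 - Real.exp u) + Real.exp u * (1 - Real.cos v)| := by ring_nf
    _ ≤ |1 - Real.exp u| + Real.exp u * |1 - Real.cos v| := by
        refine (abs_add_le _ _).trans ?_
        rw [abs_mul, abs_of_pos (Real.exp_pos u)]
    _ ≤ |u| * Real.exp |u| + Real.exp |u| * |v| := by gcongr
    _ = _ := by ring

/-- The truncated logarithmic integral `∫₀^π (1 - Re e^{-zt}) / t dt` at `z = R e^{iφ}`. -/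
noncomputable def polarLogIntegral (R φ : ℝ) : ℝ :=
  ∫ t in (0 : ℝ)..Real.pi,
    (1 - Real.exp (-(R * Real.cos φ * t)) * Real.cos (R * Real.sin φ * t)) / t

theorem abs_mul_cos_mul_le {R t : ℝ} (hR : 0 ≤ R) (ht : 0 ≤ t) (φ : ℝ) :
    |R * Real.cos φ * t| ≤ R * t ∧ |R * Real.sin φ * t| ≤ R * t := by
  rw [abs_mul, abs_mul, abs_mul, abs_mul, abs_of_nonneg hR, abs_of_nonneg ht]
  constructor
  · have := Real.abs_cos_le_one φ
    calc R * |Real.cos φ| * t ≤ R * 1 * t := by gcongr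
      _ = R * t := by ring
  · have := Real.abs_sin_le_one φ
    calc R * |Real.sin φ| * t ≤ R * 1 * t := by gcongr
      _ = R * t := by ring

/-- With `z = R e^{iφ}`, the `φ`-derivative of the integrand is `Re (i z e^{-zt})`, an exact
`t`-derivative. Only the endpoint `t = π` contributes. -/
theorem hasDerivAt_polarLogIntegral {R : ℝ} (hR : 0 ≤ R) (φ : ℝ) :
    HasDerivAt (polarLogIntegral R)
      (-(Real.exp (-(R * Real.cos φ * Real.pi)) * Real.sin (R * Real.sin φ * Real.pi))) φ := by
  have hpi := Real.pi_pos
  have key := intervalIntegral.hasDerivAt_integral_of_dominated_loc_of_deriv_le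
    (μ := MeasureTheory.volume) (a := 0) (b := Real.pi) (s := Set.univ) (x₀ := φ)
    (bound := fun _ => 2 * R * Real.exp (R * Real.pi))
    (F := fun φ t => (1 - Real.exp (-(R * Real.cos φ * t)) * Real.cos (R * Real.sin φ * t)) / t)
    (F' := fun φ t => R * Real.cos φ *
        (Real.exp (-(R * Real.cos φ * t)) * Real.sin (R * Real.sin φ * t)) -
      R * Real.sin φ * (Real.exp (-(R * Real.cos φ * t)) * Real.cos (R * Real.sin φ * t)))
    Filter.univ_mem
    (Eventually.of_forall fun x => Measurable.aestronglyMeasurable (by fun_prop))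
    (by
      refine intervalIntegrable_of_abs_le (C := 2 * R * Real.exp (R * Real.pi)) (by fun_prop)
        hpi.le fun t ht => ?_
      have ht0 := ht.1
      have ht1 := ht.2
      obtain ⟨h1, h2⟩ := abs_mul_cos_mul_le hR ht0.le φ
      rw [abs_div, abs_of_pos ht0, div_le_iff₀ ht0]
      refine (abs_one_sub_exp_mul_cos_le _ _).trans ?_
      rw [abs_neg]
      have : Real.exp |R * Real.cos φ * t| ≤ Real.exp (R * Real.pi) := by
        apply Real.exp_le_exp.2
        refine h1.trans ?_
        gcongr
      calc _ ≤ (R * t + R * t) * Real.exp (R * Real.pi) := by gcongr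
        _ = _ := by ring)
    (Measurable.aestronglyMeasurable (by fun_prop))
    (Eventually.of_forall fun t ht x _ => by
      rw [Set.uIoc_of_le hpi.le] at ht
      have ht0 := ht.1
      have ht1 := ht.2
      obtain ⟨h1, h2⟩ := abs_mul_cos_mul_le hR ht0.le x
      have h3 : Real.exp (-(R * Real.cos x * t)) ≤ Real.exp (R * Real.pi) := by
        apply Real.exp_le_exp.2
        refine (neg_le_abs _).trans (h1.trans ?_)
        gcongr
      have h4 := Real.abs_cos_le_one x
      have h5 := Real.abs_sin_le_one x
      have h6 := Real.abs_cos_le_one (R * Real.sin x * t)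
      have h7 := Real.abs_sin_le_one (R * Real.sin x * t)
      rw [Real.norm_eq_abs]
      refine (abs_sub _ _).trans ?_
      simp only [abs_mul, abs_of_nonneg hR, Real.abs_exp] at *
      calc _ ≤ R * 1 * (Real.exp (R * Real.pi) * 1) + R * 1 * (Real.exp (R * Real.pi) * 1) := by
            gcongr
        _ = _ := by ring)
    (by simp)
    (Eventually.of_forall fun t ht x _ => by
      rw [Set.uIoc_of_le hpi.le] at ht
      have ht0 := ht.1
      have d1 := ((((Real.hasDerivAt_cos x).const_mul R).mul_const t).neg.exp.mul
        ((((Real.hasDerivAt_sin x).const_mul R).mul_const t).cos)).const_sub 1 |>.div_const t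
      refine d1.congr_deriv ?_
      simp only [Pi.neg_apply]
      field_simp
      ring)
  refine key.2.congr_deriv ?_
  have := intervalIntegral.integral_eq_sub_of_hasDerivAt (a := 0) (b := Real.pi)
    (f := fun t => -(Real.exp (-(R * Real.cos φ * t)) * Real.sin (R * Real.sin φ * t)))
    (f' := fun t => R * Real.cos φ *
        (Real.exp (-(R * Real.cos φ * t)) * Real.sin (R * Real.sin φ * t)) -
      R * Real.sin φ * (Real.exp (-(R * Real.cos φ * t)) * Real.cos (R * Real.sin φ * t)))
    (fun t _ => by
      refine ((((hasDerivAt_id t).const_mul (R * Real.cos φ)).neg.exp.mul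
        (((hasDerivAt_id t).const_mul (R * Real.sin φ)).sin)).neg).congr_deriv ?_
      simp; ring)
    (by apply Continuous.intervalIntegrable; fun_prop)
  rw [this]
  simp

/-- The derivative is not small near `φ = π/2`, but `cos x ≥ 1 - 2x/π` bounds it by `e^{R(2x-π)}`,
whose integral is at most `1/(2R)`. -/
theorem abs_polarLogIntegral_sub_le {R φ : ℝ} (hR : 0 < R) (h0 : 0 ≤ φ) (h1 : φ ≤ Real.pi / 2) :
    |polarLogIntegral R φ - polarLogIntegral R 0| ≤ 1 / (2 * R) := by
  have hpi := Real.pi_pos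
  rw [← intervalIntegral.integral_eq_sub_of_hasDerivAt
    (fun x _ => hasDerivAt_polarLogIntegral hR.le x)
    (by apply Continuous.intervalIntegrable; fun_prop), ← Real.norm_eq_abs]
  have hI := intervalIntegral.integral_eq_sub_of_hasDerivAt (a := 0) (b := φ)
    (f := fun x => Real.exp (R * (2 * x - Real.pi)) / (2 * R))
    (f' := fun x => Real.exp (R * (2 * x - Real.pi)))
    (fun x _ => by
      refine (((((hasDerivAt_id x).const_mul 2).sub_const Real.pi).const_mul R).exp.div_const
        (2 * R)).congr_deriv ?_
      simp; field_simp)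
    (by apply Continuous.intervalIntegrable; fun_prop)
  calc _ ≤ ∫ x in (0 : ℝ)..φ, Real.exp (R * (2 * x - Real.pi)) := by
        refine intervalIntegral.norm_integral_le_of_norm_le h0 (Eventually.of_forall fun x hx => ?_)
          (by apply Continuous.intervalIntegrable; fun_prop)
        rw [norm_neg, norm_mul, Real.norm_eq_abs, Real.norm_eq_abs, Real.abs_exp]
        have h2 : Real.exp (-(R * Real.cos x * Real.pi)) ≤ Real.exp (R * (2 * x - Real.pi)) := by
          apply Real.exp_le_exp.2
          have := Real.one_sub_mul_le_cos hx.1.le (hx.2.trans h1)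
          have h3 : Real.pi - 2 * x ≤ Real.cos x * Real.pi := by
            calc Real.pi - 2 * x = (1 - 2 / Real.pi * x) * Real.pi := by field_simp
              _ ≤ _ := by gcongr
          nlinarith
        calc _ ≤ Real.exp (R * (2 * x - Real.pi)) * 1 := by
              gcongr
              exact Real.abs_sin_le_one _
          _ = _ := mul_one _
    _ ≤ 1 / (2 * R) := by
        rw [hI, ← sub_div]
        gcongr
        have h2 : Real.exp (R * (2 * φ - Real.pi)) ≤ 1 :=
          Real.exp_le_one_iff.2 (by nlinarith)
        have := Real.exp_pos (R * (2 * 0 - Real.pi))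
        linarith

/-- Asymptotics of the truncated logarithmic integral in the closed first quadrant. -/
theorem abs_integral_one_sub_exp_mul_cos_div_sub_le {n m R : ℝ} (hn : 0 ≤ n) (hm : 0 ≤ m)
    (hR : 0 < R) (hRe : R ^ 2 = n ^ 2 + m ^ 2) :
    |(∫ t in (0 : ℝ)..Real.pi, (1 - Real.exp (-(n * t)) * Real.cos (m * t)) / t) -
      (Real.log R + Real.log Real.pi + Real.eulerMascheroniConstant)| ≤ 1 / R := by
  have hpi := Real.pi_gt_three
  have hnR : n / R ≤ 1 := by rw [div_le_one hR]; nlinarith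
  have hnR0 : 0 ≤ n / R := by positivity
  have hc : R * Real.cos (Real.arccos (n / R)) = n := by
    rw [Real.cos_arccos (by linarith) hnR]; field_simp
  have hs : R * Real.sin (Real.arccos (n / R)) = m := by
    rw [Real.sin_arccos]
    have : 1 - (n / R) ^ 2 = (m / R) ^ 2 := by field_simp; linarith
    rw [this, Real.sqrt_sq (by positivity)]; field_simp
  have h1 := abs_polarLogIntegral_sub_le hR (Real.arccos_nonneg (n / R))
    (Real.arccos_le_pi_div_two.2 hnR0)
  -- On the real axis the integral is `Ein (Rπ)`, whose asymptotics are known.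
  have h2 : polarLogIntegral R 0 = expIntegralEin (R * Real.pi) := by
    rw [← integral_one_sub_exp_neg_mul_div hR, polarLogIntegral]
    simp
  have h3 := abs_expIntegralEin_sub_log_le (mul_pos hR Real.pi_pos)
  rw [Real.log_mul hR.ne' Real.pi_pos.ne'] at h3
  rw [h2, polarLogIntegral, hc, hs] at h1
  have h4 : 1 / (R * Real.pi) ≤ 1 / (2 * R) := by
    apply one_div_le_one_div_of_le (by positivity); nlinarith
  have h5 : 1 / (2 * R) + 1 / (2 * R) = 1 / R := by field_simp; norm_num
  rw [abs_le] at *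
  constructor <;> linarith

/-! ### The decay rate `s(t)` and its expansion at `0`. -/

/-- The positive solution `s(t)` of `cosh s + cos t = 2`. -/
noncomputable def latticeDecay (t : ℝ) : ℝ := 2 * Real.arsinh (Real.sin (t / 2))

/-- The hyperbolic sine of `latticeDecay`. -/
noncomputable def sinhDecay (t : ℝ) : ℝ :=
  2 * Real.sin (t / 2) * Real.sqrt (1 + Real.sin (t / 2) ^ 2)

/-- The derivative of `latticeDecay`. -/
noncomputable def derivDecay (t : ℝ) : ℝ :=
  Real.cos (t / 2) / Real.sqrt (1 + Real.sin (t / 2) ^ 2)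

theorem continuous_latticeDecay : Continuous latticeDecay := by
  unfold latticeDecay
  exact continuous_const.mul (Real.continuous_arsinh.comp (by fun_prop))

theorem continuous_sinhDecay : Continuous sinhDecay := by
  unfold sinhDecay; fun_prop

theorem continuous_derivDecay : Continuous derivDecay := by
  unfold derivDecay
  refine Continuous.div (by fun_prop) (by fun_prop) fun t => ?_
  positivity

/-- This relation makes `e^{-|y| s(t)} cos(xt)` lattice-harmonic off the axis `y = 0`. -/
theorem exp_add_exp_neg_latticeDecay (t : ℝ) :
    Real.exp (latticeDecay t) + Real.exp (-latticeDecay t) = 4 - 2 * Real.cos t := by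
  have h1 : Real.cosh (latticeDecay t) = 2 - Real.cos t := by
    rw [latticeDecay, Real.cosh_two_mul, Real.cosh_sq, Real.sinh_arsinh]
    have := Real.cos_two_mul (t / 2)
    rw [mul_div_cancel₀ t two_ne_zero] at this
    have := Real.sin_sq_add_cos_sq (t / 2)
    linarith
  rw [Real.cosh_eq] at h1
  linarith

theorem exp_sub_exp_neg_latticeDecay (t : ℝ) :
    Real.exp (latticeDecay t) - Real.exp (-latticeDecay t) = 2 * sinhDecay t := by
  have h1 : Real.sinh (latticeDecay t) = sinhDecay t := by
    rw [latticeDecay, Real.sinh_two_mul, Real.cosh_arsinh, Real.sinh_arsinh, sinhDecay]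
  rw [Real.sinh_eq] at h1
  linarith

theorem hasDerivAt_latticeDecay (t : ℝ) : HasDerivAt latticeDecay (derivDecay t) t := by
  refine ((((hasDerivAt_id t).div_const 2).sin.arsinh).const_mul 2).congr_deriv ?_
  simp only [derivDecay, id, smul_eq_mul]
  ring

theorem hasDerivAt_sinhDecay (t : ℝ) :
    HasDerivAt sinhDecay (derivDecay t * (1 + 2 * Real.sin (t / 2) ^ 2)) t := by
  have hs := ((hasDerivAt_id t).div_const 2).sin
  have hq := ((hs.pow 2).const_add 1).sqrt (by simp only [Pi.pow_apply]; positivity)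
  refine ((hs.const_mul 2).mul hq).congr_deriv ?_
  have h1 : Real.sqrt (1 + Real.sin (t / 2) ^ 2) ^ 2 = 1 + Real.sin (t / 2) ^ 2 :=
    Real.sq_sqrt (by positivity)
  have h2 : Real.sqrt (1 + Real.sin (t / 2) ^ 2) ≠ 0 := by positivity
  simp only [derivDecay, id, Pi.pow_apply]
  field_simp
  rw [h1]
  push_cast
  ring

section Bounds

variable {t : ℝ}

theorem half_sin_bounds (h0 : 0 ≤ t) (h1 : t ≤ Real.pi) :
    t / 4 ≤ Real.sin (t / 2) ∧ Real.sin (t / 2) ≤ t / 2 ∧ 0 ≤ Real.cos (t / 2) := by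
  have hpi := Real.pi_pos
  have hpi4 := Real.pi_le_four
  refine ⟨?_, Real.sin_le (by linarith), Real.cos_nonneg_of_mem_Icc ⟨by linarith, by linarith⟩⟩
  have := Real.mul_le_sin (x := t / 2) (by linarith) (by linarith)
  refine le_trans ?_ this
  rw [div_mul_div_comm, div_le_div_iff₀ (by norm_num) (by positivity)]
  nlinarith

theorem one_le_sqrt_one_add_sq (x : ℝ) : 1 ≤ Real.sqrt (1 + x ^ 2) :=
  Real.one_le_sqrt.2 (by nlinarith [sq_nonneg x])

theorem sqrt_one_add_sq_le (x : ℝ) : Real.sqrt (1 + x ^ 2) ≤ 1 + x ^ 2 / 2 :=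
  Real.sqrt_le_iff.2 ⟨by positivity, by nlinarith [sq_nonneg (x ^ 2)]⟩

theorem derivDecay_bounds (h0 : 0 ≤ t) (h1 : t ≤ Real.pi) :
    0 ≤ derivDecay t ∧ derivDecay t ≤ 1 ∧ 1 - derivDecay t ≤ t ^ 2 / 4 := by
  obtain ⟨a, b, c⟩ := half_sin_bounds h0 h1
  have hq := one_le_sqrt_one_add_sq (Real.sin (t / 2))
  have hq2 := sqrt_one_add_sq_le (Real.sin (t / 2))
  have hc := Real.one_sub_sq_div_two_le_cos (x := t / 2)
  have hc1 := Real.cos_le_one (t / 2)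
  have hs1 := Real.sin_le_one (t / 2)
  have hs : Real.sin (t / 2) ^ 2 ≤ t ^ 2 / 4 := by nlinarith
  rw [derivDecay]
  set q := Real.sqrt (1 + Real.sin (t / 2) ^ 2)
  set σ := Real.sin (t / 2)
  set d := Real.cos (t / 2)
  have hq0 : 0 < q := by linarith
  refine ⟨by positivity, by rw [div_le_one hq0]; linarith, ?_⟩
  have : (1 - t ^ 2 / 4) ≤ d / q := by
    rw [le_div_iff₀ hq0]
    rcases le_total 0 (1 - t ^ 2 / 4) with h | h
    · calc (1 - t ^ 2 / 4) * q ≤ (1 - t ^ 2 / 4) * (1 + t ^ 2 / 4 / 2) := by gcongr; linarith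
        _ ≤ 1 - (t / 2) ^ 2 / 2 := by nlinarith [sq_nonneg (t ^ 2)]
        _ ≤ d := hc
    · nlinarith
  linarith

theorem latticeDecay_bounds (h0 : 0 ≤ t) (h1 : t ≤ Real.pi) :
    t / 4 ≤ latticeDecay t ∧ latticeDecay t ≤ t ∧ t - latticeDecay t ≤ t ^ 3 / 12 := by
  obtain ⟨a, b, c⟩ := half_sin_bounds h0 h1
  have hz : latticeDecay 0 = 0 := by simp [latticeDecay]
  refine ⟨?_, ?_, ?_⟩
  · have hs1 := Real.sin_le_one (t / 2)
    set σ := Real.sin (t / 2) with hσ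
    have hσ0 : 0 ≤ σ := by linarith
    -- `arsinh σ ≥ log (1 + σ) ≥ σ/(1 + σ) ≥ σ/2`, the last because `σ ≤ 1`.
    have h2 : σ / 2 ≤ Real.arsinh σ := by
      rw [Real.arsinh]
      have h3 := Real.one_sub_inv_le_log_of_pos (x := 1 + σ) (by linarith)
      have h4 : Real.log (1 + σ) ≤ Real.log (σ + Real.sqrt (1 + σ ^ 2)) := by
        apply Real.log_le_log (by linarith)
        linarith [one_le_sqrt_one_add_sq σ]
      have h5 : σ / 2 ≤ 1 - (1 + σ)⁻¹ := by
        have : 1 - (1 + σ)⁻¹ = σ / (1 + σ) := by field_simp; ring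
        rw [this]
        gcongr; linarith
      linarith
    rw [latticeDecay, ← hσ]
    linarith
  · have hm : MonotoneOn (fun x => x - latticeDecay x) (Set.Icc 0 Real.pi) := by
      refine monotoneOn_of_hasDerivWithinAt_nonneg (f' := fun x => 1 - derivDecay x)
        (convex_Icc _ _) (continuous_id.sub continuous_latticeDecay).continuousOn
        (fun x _ => ((hasDerivAt_id x).sub (hasDerivAt_latticeDecay x)).hasDerivWithinAt) ?_
      intro x hx
      rw [interior_Icc] at hx
      have := derivDecay_bounds hx.1.le hx.2.le
      linarith
    have := hm ⟨le_rfl, Real.pi_pos.le⟩ ⟨h0, h1⟩ h0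
    simp only [hz] at this
    linarith
  · have hm : MonotoneOn (fun x => x ^ 3 / 12 - (x - latticeDecay x)) (Set.Icc 0 Real.pi) := by
      refine monotoneOn_of_hasDerivWithinAt_nonneg
        (f' := fun x => 3 * x ^ 2 / 12 - (1 - derivDecay x)) (convex_Icc _ _)
        (Continuous.continuousOn (by have := continuous_latticeDecay; fun_prop))
        (fun x _ => by
          have := (((hasDerivAt_id x).pow 3).div_const 12).sub
            ((hasDerivAt_id x).sub (hasDerivAt_latticeDecay x))
          refine (this.congr_deriv ?_).hasDerivWithinAt
          simp) ?_
      intro x hx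
      rw [interior_Icc] at hx
      have := derivDecay_bounds hx.1.le hx.2.le
      linarith
    have := hm ⟨le_rfl, Real.pi_pos.le⟩ ⟨h0, h1⟩ h0
    simp only [hz] at this
    linarith

theorem sinhDecay_bounds (h0 : 0 ≤ t) (h1 : t ≤ Real.pi) :
    t / 2 ≤ sinhDecay t ∧ |sinhDecay t - t| ≤ t ^ 3 / 8 ∧
      |1 - derivDecay t * (1 + 2 * Real.sin (t / 2) ^ 2)| ≤ t ^ 2 := by
  obtain ⟨a, b, c⟩ := half_sin_bounds h0 h1
  obtain ⟨d0, d1, d2⟩ := derivDecay_bounds h0 h1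
  obtain ⟨e0, e1, e2⟩ := latticeDecay_bounds h0 h1
  have hq := one_le_sqrt_one_add_sq (Real.sin (t / 2))
  have hq2 := sqrt_one_add_sq_le (Real.sin (t / 2))
  have hs : Real.sin (t / 2) ^ 2 ≤ t ^ 2 / 4 := by nlinarith
  have hσ0 : 0 ≤ Real.sin (t / 2) := by linarith
  have hS : 2 * Real.sin (t / 2) ≤ sinhDecay t := by
    rw [sinhDecay]; nlinarith
  have ht3 : 0 ≤ t ^ 3 := by positivity
  have hsS : latticeDecay t ≤ sinhDecay t := by
    have h2 : Real.arsinh (Real.sin (t / 2)) ≤ Real.sin (t / 2) := by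
      rw [← Real.sinh_le_sinh, Real.sinh_arsinh]
      exact Real.self_le_sinh_iff.2 hσ0
    rw [latticeDecay]; linarith
  refine ⟨by linarith, ?_, ?_⟩
  · rw [abs_le]
    refine ⟨by linarith, ?_⟩
    have : sinhDecay t ≤ 2 * (t / 2) * (1 + t ^ 2 / 4 / 2) := by
      rw [sinhDecay]
      gcongr
      linarith
    nlinarith
  · rw [abs_le]
    have h2 : derivDecay t * Real.sin (t / 2) ^ 2 ≤ 1 * (t ^ 2 / 4) := by gcongr
    have h3 : 0 ≤ derivDecay t * Real.sin (t / 2) ^ 2 := by positivity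
    constructor <;> nlinarith

end Bounds

/-! ### The regular part, source of `(3/2) log 2`. -/

/-- The regular part `1 / sinh s(t) - 1 / t`, extended by `0` at `t = 0`. -/
noncomputable def regularPart (t : ℝ) : ℝ := 1 / sinhDecay t - 1 / t

/-- The derivative of `regularPart` away from `0`. -/
noncomputable def derivRegularPart (t : ℝ) : ℝ :=
  -(derivDecay t * (1 + 2 * Real.sin (t / 2) ^ 2)) / sinhDecay t ^ 2 + 1 / t ^ 2

theorem measurable_regularPart : Measurable regularPart := by
  have := continuous_sinhDecay.measurable
  unfold regularPart; fun_prop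

theorem measurable_derivRegularPart : Measurable derivRegularPart := by
  have := continuous_sinhDecay.measurable
  have := continuous_derivDecay.measurable
  unfold derivRegularPart; fun_prop

theorem abs_regularPart_le {t : ℝ} (h0 : 0 < t) (h1 : t ≤ Real.pi) : |regularPart t| ≤ t / 4 := by
  obtain ⟨a, b, c⟩ := sinhDecay_bounds h0.le h1
  have hS : 0 < sinhDecay t := by linarith
  have e : regularPart t = -(sinhDecay t - t) / (sinhDecay t * t) := by
    rw [regularPart]; field_simp; ring
  rw [e, abs_div, abs_neg, abs_of_pos (by positivity : 0 < sinhDecay t * t),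
    div_le_iff₀ (by positivity)]
  refine b.trans ?_
  have : t / 4 * (t / 2 * t) ≤ t / 4 * (sinhDecay t * t) := by gcongr
  nlinarith

/-- The `1/t²` singularities cancel: over a common denominator of order `t⁴`, the numerator is
written through `S - t = O(t³)` and `1 - D = O(t²)`, hence is `O(t⁴)`. -/
theorem abs_derivRegularPart_le {t : ℝ} (h0 : 0 < t) (h1 : t ≤ Real.pi) :
    |derivRegularPart t| ≤ 8 := by
  obtain ⟨a, b, c⟩ := sinhDecay_bounds h0.le h1
  have hpi4 := Real.pi_le_four
  have hS : 0 < sinhDecay t := by linarith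
  rw [derivRegularPart]
  set D := derivDecay t * (1 + 2 * Real.sin (t / 2) ^ 2)
  set S := sinhDecay t
  have e : -D / S ^ 2 + 1 / t ^ 2 = ((S - t) * ((S - t) + 2 * t) + t ^ 2 * (1 - D)) /
      (S ^ 2 * t ^ 2) := by
    field_simp; ring
  rw [e, abs_div, abs_of_pos (by positivity : 0 < S ^ 2 * t ^ 2), div_le_iff₀ (by positivity)]
  have hb : |S - t + 2 * t| ≤ t ^ 3 / 8 + 2 * t := by
    refine (abs_add_le _ _).trans ?_
    rw [abs_of_pos (by positivity : 0 < 2 * t)]; linarith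
  have ht2 : t ^ 2 ≤ 16 := by nlinarith
  calc _ ≤ |S - t| * |S - t + 2 * t| + t ^ 2 * |1 - D| := by
        refine (abs_add_le _ _).trans ?_
        rw [abs_mul, abs_mul, abs_of_nonneg (sq_nonneg t)]
    _ ≤ t ^ 3 / 8 * (t ^ 3 / 8 + 2 * t) + t ^ 2 * t ^ 2 := by gcongr
    _ = t ^ 4 * (t ^ 2 / 64 + 5 / 4) := by ring
    _ ≤ t ^ 4 * 2 := by gcongr; linarith
    _ = 8 * ((t / 2) ^ 2 * t ^ 2) := by ring
    _ ≤ 8 * (S ^ 2 * t ^ 2) := by gcongr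

theorem intervalIntegrable_regularPart :
    IntervalIntegrable regularPart MeasureTheory.volume 0 Real.pi :=
  intervalIntegrable_of_abs_le (C := 1) measurable_regularPart Real.pi_pos.le fun t ht =>
    (abs_regularPart_le ht.1 ht.2).trans (by linarith [ht.2, Real.pi_le_four])

/-- With `σ = sin(t/2)`, `log σ - log (√(1+σ²) + cos(t/2))` is a primitive of `1/sinh s`.
Subtracting `log (t/2)` turns `log σ` into `log (sinc (t/2))`, which is continuous at `0`. -/
theorem integral_regularPart :
    ∫ t in (0 : ℝ)..Real.pi, regularPart t = 3 / 2 * Real.log 2 - Real.log Real.pi := by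
  have hpi := Real.pi_pos
  have hden : ∀ t ∈ Set.Icc 0 Real.pi,
      0 < Real.sqrt (1 + Real.sin (t / 2) ^ 2) + Real.cos (t / 2) := fun t ht => by
    linarith [(half_sin_bounds ht.1 ht.2).2.2, one_le_sqrt_one_add_sq (Real.sin (t / 2))]
  have hsinc : ∀ t ∈ Set.Icc 0 Real.pi, 0 < Real.sinc (t / 2) := fun t ht => by
    rcases eq_or_lt_of_le ht.1 with h | h
    · rw [← h]; simp
    · rw [Real.sinc_of_ne_zero (by positivity)]
      have := (half_sin_bounds ht.1 ht.2).1
      exact div_pos (by linarith) (by linarith)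
  have := intervalIntegral.integral_eq_sub_of_hasDerivAt_of_le (a := 0) (b := Real.pi)
    (f := fun t => Real.log (Real.sinc (t / 2)) -
      Real.log (Real.sqrt (1 + Real.sin (t / 2) ^ 2) + Real.cos (t / 2)))
    (f' := regularPart) hpi.le
    (by
      refine ContinuousOn.sub (ContinuousOn.log ?_ fun t ht => (hsinc t ht).ne')
        (ContinuousOn.log (by fun_prop) fun t ht => (hden t ht).ne')
      exact (Real.continuous_sinc.comp (by fun_prop)).continuousOn)
    (fun t ht => by
      have h0 := ht.1
      have hs : 0 < Real.sin (t / 2) := by linarith [(half_sin_bounds ht.1.le ht.2.le).1]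
      have hd := hden t ⟨ht.1.le, ht.2.le⟩
      have ds := ((hasDerivAt_id t).div_const 2).sin
      have dc := ((hasDerivAt_id t).div_const 2).cos
      have dq := ((ds.pow 2).const_add 1).sqrt (by simp only [Pi.pow_apply]; positivity)
      have d := ((ds.log hs.ne').sub (((hasDerivAt_id t).div_const 2).log (by simp; exact h0.ne'))).sub
        ((dq.add dc).log hd.ne')
      have heq : (fun t => Real.log (Real.sinc (t / 2)) -
          Real.log (Real.sqrt (1 + Real.sin (t / 2) ^ 2) + Real.cos (t / 2))) =ᶠ[nhds t]
          (fun t => Real.log (Real.sin (t / 2)) - Real.log (t / 2) -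
            Real.log (Real.sqrt (1 + Real.sin (t / 2) ^ 2) + Real.cos (t / 2))) := by
        filter_upwards [Ioo_mem_nhds ht.1 ht.2] with x hx
        have hx0 := hx.1
        have : 0 < Real.sin (x / 2) := by linarith [(half_sin_bounds hx.1.le hx.2.le).1]
        rw [Real.sinc_of_ne_zero (by positivity), Real.log_div this.ne' (by positivity)]
      refine (d.congr_of_eventuallyEq heq).congr_deriv ?_
      simp only [id, Pi.pow_apply, Pi.add_apply, regularPart, sinhDecay]
      have h1 : Real.sqrt (1 + Real.sin (t / 2) ^ 2) ^ 2 = 1 + Real.sin (t / 2) ^ 2 :=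
        Real.sq_sqrt (by positivity)
      have h2 : Real.sqrt (1 + Real.sin (t / 2) ^ 2) ≠ 0 := by positivity
      have h3 := Real.sin_sq_add_cos_sq (t / 2)
      have hd' := hd.ne'
      set σ := Real.sin (t / 2)
      set c := Real.cos (t / 2)
      set q := Real.sqrt (1 + σ ^ 2)
      push_cast
      have hσ := hs.ne'
      have ht' := h0.ne'
      field_simp
      linear_combination (t * q) * h3 + (c * t) * h1)
    intervalIntegrable_regularPart
  rw [this]
  have e1 : Real.sinc (Real.pi / 2) = 2 / Real.pi := by
    rw [Real.sinc_of_ne_zero (by positivity), Real.sin_pi_div_two]; field_simp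
  simp only [e1, zero_div, Real.sinc_zero, Real.sin_zero, Real.cos_zero, Real.sin_pi_div_two,
    Real.cos_pi_div_two, Real.log_one]
  rw [Real.log_div two_ne_zero hpi.ne']
  norm_num
  rw [Real.log_sqrt (by norm_num)]
  ring

/-! ### The error between lattice and continuum kernels. -/

/-- The difference `e^{-n s(t)} / sinh s(t) - e^{-n t} / t` between the lattice kernel and the
continuum kernel. -/
noncomputable def kernelError (n t : ℝ) : ℝ :=
  Real.exp (-(n * latticeDecay t)) / sinhDecay t - Real.exp (-(n * t)) / t

/-- The derivative of `kernelError n` away from `0`. -/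
noncomputable def derivKernelError (n t : ℝ) : ℝ :=
  Real.exp (-(n * latticeDecay t)) * derivRegularPart t
    - n * derivDecay t * Real.exp (-(n * latticeDecay t)) * regularPart t
    + (n * (1 - derivDecay t) * Real.exp (-(n * latticeDecay t))
      - n * (Real.exp (-(n * latticeDecay t)) - Real.exp (-(n * t)))) / t
    - (Real.exp (-(n * latticeDecay t)) - Real.exp (-(n * t))) / t ^ 2

theorem measurable_derivKernelError (n : ℝ) : Measurable (derivKernelError n) := by
  have := continuous_derivDecay.measurable
  have := continuous_latticeDecay.measurable
  have := measurable_regularPart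
  have := measurable_derivRegularPart
  unfold derivKernelError; fun_prop

theorem hasDerivAt_kernelError (n : ℝ) {t : ℝ} (h0 : 0 < t) (h1 : t ≤ Real.pi) :
    HasDerivAt (kernelError n) (derivKernelError n t) t := by
  have hS : sinhDecay t ≠ 0 := by linarith [(sinhDecay_bounds h0.le h1).1]
  have h0' := h0.ne'
  have := (((hasDerivAt_latticeDecay t).const_mul n).neg.exp.div (hasDerivAt_sinhDecay t) hS).sub
    (((hasDerivAt_id t).const_mul n).neg.exp.div (hasDerivAt_id t) h0')
  refine this.congr_deriv ?_
  simp only [derivKernelError, derivRegularPart, regularPart, Pi.neg_apply, id]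
  field_simp
  ring

section Bounds

variable {n t : ℝ}

theorem mul_exp_neg_quarter_le (x : ℝ) : x * Real.exp (-(x / 4)) ≤ 4 := by
  have := mul_exp_neg_le (c := 1 / 4) (t := x) (by norm_num)
  rw [one_div_mul_eq_div] at this
  norm_num at this
  exact this

theorem sq_mul_exp_neg_quarter_le {x : ℝ} (hx : 0 ≤ x) : x ^ 2 * Real.exp (-(x / 4)) ≤ 64 := by
  have := mul_exp_neg_le (c := 1 / 8) (t := x) (by norm_num)
  rw [one_div_mul_eq_div] at this
  norm_num at this
  have h2 : Real.exp (-(x / 4)) = Real.exp (-(x / 8)) ^ 2 := by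
    rw [← Real.exp_nat_mul]; congr 1; push_cast; ring
  rw [h2, ← mul_pow]
  calc _ ≤ (8 : ℝ) ^ 2 := by gcongr
    _ = 64 := by norm_num

theorem exp_neg_mul_latticeDecay_le (hn : 0 ≤ n) (h0 : 0 ≤ t) (h1 : t ≤ Real.pi) :
    Real.exp (-(n * latticeDecay t)) ≤ Real.exp (-(n * t / 4)) := by
  apply Real.exp_le_exp.2
  have := mul_le_mul_of_nonneg_left (latticeDecay_bounds h0 h1).1 hn
  linarith

theorem exp_neg_mul_latticeDecay_sub_mem (hn : 0 ≤ n) (h0 : 0 ≤ t) (h1 : t ≤ Real.pi) :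
    0 ≤ Real.exp (-(n * latticeDecay t)) - Real.exp (-(n * t)) ∧
      Real.exp (-(n * latticeDecay t)) - Real.exp (-(n * t)) ≤
        n * t ^ 3 / 12 * Real.exp (-(n * t / 4)) := by
  obtain ⟨a, b, c⟩ := latticeDecay_bounds h0 h1
  have hE := exp_neg_mul_latticeDecay_le hn h0 h1
  refine ⟨sub_nonneg.2 (Real.exp_le_exp.2 (by nlinarith)), ?_⟩
  have e : Real.exp (-(n * t)) =
      Real.exp (-(n * latticeDecay t)) * Real.exp (-(n * (t - latticeDecay t))) := by
    rw [← Real.exp_add]; congr 1; ring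
  have h2 := Real.add_one_le_exp (-(n * (t - latticeDecay t)))
  have h3 : n * (t - latticeDecay t) ≤ n * (t ^ 3 / 12) := by gcongr
  rw [e]
  calc _ = Real.exp (-(n * latticeDecay t)) * (1 - Real.exp (-(n * (t - latticeDecay t)))) := by
        ring
    _ ≤ Real.exp (-(n * latticeDecay t)) * (n * (t ^ 3 / 12)) := by gcongr; linarith
    _ ≤ Real.exp (-(n * t / 4)) * (n * (t ^ 3 / 12)) := by gcongr
    _ = _ := by ring

/-- Change the denominator first (`regularPart`), then the exponent, using `t - s(t) ≤ t³/12`. -/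
theorem abs_kernelError_le (hn : 0 ≤ n) (h0 : 0 < t) (h1 : t ≤ Real.pi) :
    |kernelError n t| ≤ (t / 4 + n * t ^ 2 / 12) * Real.exp (-(n * t / 4)) := by
  obtain ⟨a, b⟩ := exp_neg_mul_latticeDecay_sub_mem hn h0.le h1
  have hE := exp_neg_mul_latticeDecay_le hn h0.le h1
  have hk := abs_regularPart_le h0 h1
  have hS : sinhDecay t ≠ 0 := by linarith [(sinhDecay_bounds h0.le h1).1]
  have e : kernelError n t = Real.exp (-(n * latticeDecay t)) * regularPart t +
      (Real.exp (-(n * latticeDecay t)) - Real.exp (-(n * t))) / t := by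
    rw [kernelError, regularPart]; field_simp; ring
  rw [e]
  refine (abs_add_le _ _).trans ?_
  rw [abs_mul, abs_div, Real.abs_exp, abs_of_nonneg a, abs_of_pos h0]
  calc _ ≤ Real.exp (-(n * t / 4)) * (t / 4) + n * t ^ 3 / 12 * Real.exp (-(n * t / 4)) / t := by
        gcongr
    _ = _ := by field_simp

theorem mul_abs_kernelError_le (hn : 0 ≤ n) (h0 : 0 < t) (h1 : t ≤ Real.pi) :
    n * |kernelError n t| ≤ 7 := by
  have h2 := mul_exp_neg_quarter_le (n * t)
  have h3 := sq_mul_exp_neg_quarter_le (x := n * t) (by positivity)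
  have h4 := mul_le_mul_of_nonneg_left (abs_kernelError_le hn h0 h1) hn
  nlinarith

/-- Every factor `n` is matched by a factor `t`, and `e^{-nt/4}` absorbs `nt` and `(nt)²`.
Uniformity in `n` is what the integration by parts needs. -/
theorem abs_derivKernelError_le (hn : 0 ≤ n) (h0 : 0 < t) (h1 : t ≤ Real.pi) :
    |derivKernelError n t| ≤ 20 := by
  obtain ⟨a, b⟩ := exp_neg_mul_latticeDecay_sub_mem hn h0.le h1
  obtain ⟨d0, d1, d2⟩ := derivDecay_bounds h0.le h1
  have hE := exp_neg_mul_latticeDecay_le hn h0.le h1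
  have hk := abs_regularPart_le h0 h1
  have hk' := abs_derivRegularPart_le h0 h1
  have h2 := mul_exp_neg_quarter_le (n * t)
  have h3 := sq_mul_exp_neg_quarter_le (x := n * t) (by positivity)
  have hE1 : Real.exp (-(n * t / 4)) ≤ 1 := Real.exp_le_one_iff.2 (by
    have : 0 ≤ n * t / 4 := by positivity
    linarith)
  have hE0 := Real.exp_pos (-(n * latticeDecay t))
  have hd : 0 ≤ 1 - derivDecay t := by linarith
  rw [derivKernelError]
  set E := Real.exp (-(n * latticeDecay t))
  set F := Real.exp (-(n * t))
  set e := Real.exp (-(n * t / 4))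
  have he : 0 < e := Real.exp_pos _
  have t1 : |E * derivRegularPart t| ≤ 8 := by
    rw [abs_mul, abs_of_pos hE0]
    nlinarith [abs_nonneg (derivRegularPart t)]
  have t2 : |n * derivDecay t * E * regularPart t| ≤ 1 := by
    rw [abs_mul, abs_of_nonneg (by positivity : 0 ≤ n * derivDecay t * E)]
    calc _ ≤ n * 1 * e * (t / 4) := by gcongr
      _ ≤ 1 := by linarith
  have t3 : |n * (1 - derivDecay t) * E / t| ≤ 1 := by
    rw [abs_of_nonneg (by positivity), div_le_iff₀ h0]
    calc _ ≤ n * (t ^ 2 / 4) * e := by gcongr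
      _ = (n * t * e) / 4 * t := by ring
      _ ≤ 1 * t := by gcongr; linarith
  have t4 : |n * (E - F) / t| ≤ 6 := by
    rw [abs_of_nonneg (by positivity), div_le_iff₀ h0]
    calc _ ≤ n * (n * t ^ 3 / 12 * e) := by gcongr
      _ = ((n * t) ^ 2 * e) / 12 * t := by ring
      _ ≤ 6 * t := by gcongr; linarith
  have t5 : |(E - F) / t ^ 2| ≤ 1 := by
    rw [abs_of_nonneg (by positivity), div_le_iff₀ (by positivity)]
    calc _ ≤ n * t ^ 3 / 12 * e := b
      _ = (n * t * e) / 12 * t ^ 2 := by ring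
      _ ≤ 1 * t ^ 2 := by gcongr; linarith
  rw [sub_div]
  rw [abs_le] at *
  constructor <;> linarith

end Bounds

theorem kernelError_zero (n : ℝ) : kernelError n 0 = 0 := by
  simp [kernelError, sinhDecay]

theorem continuousOn_kernelError {n : ℝ} (hn : 0 ≤ n) :
    ContinuousOn (kernelError n) (Set.Icc 0 Real.pi) := by
  intro t ht
  rcases eq_or_lt_of_le ht.1 with h | h
  · subst h
    rw [ContinuousWithinAt, kernelError_zero]
    have hb : Tendsto (fun t : ℝ => (t / 4 + n * t ^ 2 / 12) * Real.exp (-(n * t / 4)))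
        (nhdsWithin 0 (Set.Icc 0 Real.pi)) (nhds 0) := by
      have : Continuous (fun t : ℝ => (t / 4 + n * t ^ 2 / 12) * Real.exp (-(n * t / 4))) := by
        fun_prop
      have := this.tendsto 0
      simp only [zero_div, mul_zero, ne_eq, OfNat.ofNat_ne_zero, not_false_eq_true, zero_pow,
        add_zero, zero_mul] at this
      exact this.mono_left nhdsWithin_le_nhds
    refine squeeze_zero_norm' ?_ hb
    filter_upwards [self_mem_nhdsWithin] with x hx
    rcases eq_or_lt_of_le hx.1 with h | h
    · rw [← h, kernelError_zero]; simp
    · exact abs_kernelError_le hn h hx.2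
  · exact (hasDerivAt_kernelError n h ht.2).continuousAt.continuousWithinAt

theorem intervalIntegrable_kernelError_mul_cos {n : ℝ} (hn : 0 ≤ n) (m : ℝ) :
    IntervalIntegrable (fun t => kernelError n t * Real.cos (m * t)) MeasureTheory.volume 0
      Real.pi := by
  refine ContinuousOn.intervalIntegrable ?_
  rw [Set.uIcc_of_le Real.pi_pos.le]
  exact (continuousOn_kernelError hn).mul (by fun_prop)

theorem mul_abs_integral_kernelError_mul_cos_le {n : ℝ} (hn : 0 ≤ n) (m : ℝ) :
    n * |∫ t in (0 : ℝ)..Real.pi, kernelError n t * Real.cos (m * t)| ≤ 28 := by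
  rw [← abs_of_nonneg hn, ← abs_mul, ← intervalIntegral.integral_const_mul, ← Real.norm_eq_abs,
    abs_of_nonneg hn]
  have := intervalIntegral.norm_integral_le_of_norm_le_const (a := 0) (b := Real.pi) (C := 7)
    (f := fun t => n * (kernelError n t * Real.cos (m * t))) (fun t ht => by
      rw [Set.uIoc_of_le Real.pi_pos.le] at ht
      rw [Real.norm_eq_abs, abs_mul, abs_mul, abs_of_nonneg hn, ← mul_assoc]
      have h1 := mul_abs_kernelError_le hn ht.1 ht.2
      have h2 := Real.abs_cos_le_one (m * t)
      calc _ ≤ (7 : ℝ) * 1 := by gcongr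
        _ = 7 := by norm_num)
  rw [sub_zero, abs_of_pos Real.pi_pos] at this
  linarith [Real.pi_le_four]

/-- Integrate by parts. The boundary terms vanish since `sin (mπ) = 0` for integral `m`; the bound
`20` on the derivative and `π ≤ 4` give `80`. -/
theorem mul_abs_integral_kernelError_mul_cos_le' {n : ℝ} (hn : 0 ≤ n) (m : ℕ) :
    m * |∫ t in (0 : ℝ)..Real.pi, kernelError n t * Real.cos (m * t)| ≤ 80 := by
  have hpi := Real.pi_pos
  have hi : IntervalIntegrable (derivKernelError n) MeasureTheory.volume 0 Real.pi :=
    intervalIntegrable_of_abs_le (C := 20) (measurable_derivKernelError n) hpi.le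
      fun t ht => abs_derivKernelError_le hn ht.1 ht.2
  have hs : ∀ t : ℝ, HasDerivAt (fun t => Real.sin (m * t)) (m * Real.cos (m * t)) t := fun t =>
    ((hasDerivAt_id t).const_mul (m : ℝ)).sin.congr_deriv (by simp [mul_comm])
  have key := intervalIntegral.integral_mul_deriv_eq_deriv_mul_of_hasDerivAt (a := 0) (b := Real.pi)
    (u := kernelError n) (u' := derivKernelError n) (v := fun t => Real.sin (m * t))
    (v' := fun t => m * Real.cos (m * t))
    (by rw [Set.uIcc_of_le hpi.le]; exact continuousOn_kernelError hn)
    (by fun_prop)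
    (fun t ht => by
      rw [min_eq_left hpi.le, max_eq_right hpi.le] at ht
      exact hasDerivAt_kernelError n ht.1 ht.2.le)
    (fun t _ => hs t) hi (by apply Continuous.intervalIntegrable; fun_prop)
  have e : ∫ t in (0 : ℝ)..Real.pi, kernelError n t * (m * Real.cos (m * t)) =
      m * ∫ t in (0 : ℝ)..Real.pi, kernelError n t * Real.cos (m * t) := by
    rw [← intervalIntegral.integral_const_mul]; congr 1; ext t; ring
  rw [e, Real.sin_nat_mul_pi, mul_zero, mul_zero, Real.sin_zero, mul_zero, sub_zero, zero_sub]
    at key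
  have hm : (0 : ℝ) ≤ m := Nat.cast_nonneg m
  rw [← abs_of_nonneg hm, ← abs_mul, abs_of_nonneg hm, key, abs_neg, ← Real.norm_eq_abs]
  have := intervalIntegral.norm_integral_le_of_norm_le_const (a := 0) (b := Real.pi) (C := 20)
    (f := fun t => derivKernelError n t * Real.sin (m * t)) (fun t ht => by
      rw [Set.uIoc_of_le hpi.le] at ht
      rw [Real.norm_eq_abs, abs_mul]
      have h1 := abs_derivKernelError_le hn ht.1 ht.2
      have h2 := Real.abs_sin_le_one (m * t)
      calc _ ≤ (20 : ℝ) * 1 := by gcongr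
        _ = 20 := by norm_num)
  rw [sub_zero, abs_of_pos Real.pi_pos] at this
  linarith [Real.pi_le_four]

/-! ### The potential kernel: asymptotics and Laplacian. -/

/-- The integrand of the lattice potential kernel. -/
noncomputable def potentialIntegrand (n m t : ℝ) : ℝ :=
  (1 - Real.exp (-(n * latticeDecay t)) * Real.cos (m * t)) / sinhDecay t

theorem intervalIntegrable_one_sub_exp_mul_cos_div {n : ℝ} (hn : 0 ≤ n) (m : ℝ) :
    IntervalIntegrable (fun t => (1 - Real.exp (-(n * t)) * Real.cos (m * t)) / t)
      MeasureTheory.volume 0 Real.pi := by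
  refine intervalIntegrable_of_abs_le (C := (n + |m|) * Real.exp (n * Real.pi)) (by fun_prop)
    Real.pi_pos.le fun t ht => ?_
  have h0 := ht.1
  have h1 := ht.2
  rw [abs_div, abs_of_pos h0, div_le_iff₀ h0]
  refine (abs_one_sub_exp_mul_cos_le _ _).trans ?_
  rw [abs_neg, abs_mul, abs_mul, abs_of_pos h0, abs_of_nonneg hn]
  calc _ ≤ (n * t + |m| * t) * Real.exp (n * Real.pi) := by gcongr
    _ = _ := by ring

theorem potentialIntegrand_eq (n m : ℝ) {t : ℝ} (h0 : 0 < t) (h1 : t ≤ Real.pi) :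
    potentialIntegrand n m t = (1 - Real.exp (-(n * t)) * Real.cos (m * t)) / t + regularPart t -
      kernelError n t * Real.cos (m * t) := by
  have hS : sinhDecay t ≠ 0 := by linarith [(sinhDecay_bounds h0.le h1).1]
  rw [potentialIntegrand, regularPart, kernelError]
  field_simp
  ring

theorem intervalIntegrable_potentialIntegrand {n : ℝ} (hn : 0 ≤ n) (m : ℝ) :
    IntervalIntegrable (potentialIntegrand n m) MeasureTheory.volume 0 Real.pi := by
  refine (((intervalIntegrable_one_sub_exp_mul_cos_div hn m).add
    intervalIntegrable_regularPart).sub (intervalIntegrable_kernelError_mul_cos hn m)).congr ?_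
  intro t ht
  rw [Set.uIoc_of_le Real.pi_pos.le] at ht
  exact (potentialIntegrand_eq n m ht.1 ht.2).symm

theorem abs_integral_potentialIntegrand_sub_le {n m : ℕ} {R : ℝ} (hR : 0 < R)
    (hRe : R ^ 2 = (n : ℝ) ^ 2 + (m : ℝ) ^ 2) :
    |(∫ t in (0 : ℝ)..Real.pi, potentialIntegrand n m t) - (Real.log R + kappa)| ≤ 109 / R := by
  have hn : (0 : ℝ) ≤ n := Nat.cast_nonneg n
  have hm : (0 : ℝ) ≤ m := Nat.cast_nonneg m
  have e : ∫ t in (0 : ℝ)..Real.pi, potentialIntegrand n m t =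
      (∫ t in (0 : ℝ)..Real.pi, (1 - Real.exp (-(n * t)) * Real.cos (m * t)) / t) +
      (3 / 2 * Real.log 2 - Real.log Real.pi) -
      ∫ t in (0 : ℝ)..Real.pi, kernelError n t * Real.cos (m * t) := by
    rw [← integral_regularPart, ← intervalIntegral.integral_add
      (intervalIntegrable_one_sub_exp_mul_cos_div hn m) intervalIntegrable_regularPart,
      ← intervalIntegral.integral_sub ((intervalIntegrable_one_sub_exp_mul_cos_div hn m).add
        intervalIntegrable_regularPart) (intervalIntegrable_kernelError_mul_cos hn m)]
    refine intervalIntegral.integral_congr_ae (Eventually.of_forall fun t ht => ?_)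
    rw [Set.uIoc_of_le Real.pi_pos.le] at ht
    exact potentialIntegrand_eq n m ht.1 ht.2
  have h1 := abs_integral_one_sub_exp_mul_cos_div_sub_le hn hm hR hRe
  have h2 := mul_abs_integral_kernelError_mul_cos_le hn (m : ℝ)
  have h3 := mul_abs_integral_kernelError_mul_cos_le' hn m
  have h4 : |∫ t in (0 : ℝ)..Real.pi, kernelError n t * Real.cos (m * t)| ≤ 108 / R := by
    rw [le_div_iff₀ hR]
    -- This combines decay in `n` and in `m` into decay in `R`: `28 + 80 = 108`.
    have : R ≤ n + m := by nlinarith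
    nlinarith [abs_nonneg (∫ t in (0 : ℝ)..Real.pi, kernelError n t * Real.cos (m * t))]
  have h5 : 109 / R = 1 / R + 108 / R := by ring
  rw [e, kappa, h5]
  rw [abs_le] at *
  constructor <;> linarith

/-- The (unnormalized) Laplacian of the square lattice. -/
def latticeLaplacian (f : ℤ × ℤ → ℝ) (x : ℤ × ℤ) : ℝ :=
  f (x.1 + 1, x.2) + f (x.1 - 1, x.2) + f (x.1, x.2 + 1) + f (x.1, x.2 - 1) - 4 * f x

/-- The potential kernel of the square lattice. -/
noncomputable def potentialKernel (x : ℤ × ℤ) : ℝ :=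
  2 / Real.pi * ∫ t in (0 : ℝ)..Real.pi, potentialIntegrand |(x.2 : ℝ)| x.1 t

theorem potentialKernel_zero : potentialKernel 0 = 0 := by
  simp [potentialKernel, potentialIntegrand]

/-- Away from `0` this is the exponential recurrence; the kink of `|y|` at `0` produces the defect
`2 sinh s`. -/
theorem exp_neg_abs_mul_add (y : ℤ) (s : ℝ) :
    Real.exp (-(|((y + 1 : ℤ) : ℝ)| * s)) + Real.exp (-(|((y - 1 : ℤ) : ℝ)| * s)) =
      Real.exp (-(|(y : ℝ)| * s)) * (Real.exp s + Real.exp (-s)) -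
        if y = 0 then Real.exp s - Real.exp (-s) else 0 := by
  rcases lt_trichotomy y 0 with h | h | h
  · rw [if_neg h.ne, abs_of_nonpos (by exact_mod_cast h), abs_of_nonpos (by norm_cast; omega),
      abs_of_nonpos (by exact_mod_cast h.le), mul_add, ← Real.exp_add, ← Real.exp_add]
    push_cast
    ring_nf
  · subst h
    norm_num
  · rw [if_neg h.ne', abs_of_nonneg (by norm_cast; omega), abs_of_nonneg (by norm_cast; omega),
      abs_of_nonneg (by exact_mod_cast h.le), mul_add, ← Real.exp_add, ← Real.exp_add]
    push_cast
    ring_nf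

/-- The defect on the axis, `2 sinh s · cos(xt)`, is divided by `sinh s`; hence that normalization
of the integrand. Integrating `2 cos(xt)` over `[0, π]` then leaves mass only at `x = 0`. -/
theorem potentialIntegrand_laplacian (x y : ℤ) {t : ℝ} (h0 : 0 < t) (h1 : t ≤ Real.pi) :
    potentialIntegrand |(y : ℝ)| (x + 1 : ℤ) t + potentialIntegrand |(y : ℝ)| (x - 1 : ℤ) t +
      potentialIntegrand |((y + 1 : ℤ) : ℝ)| x t + potentialIntegrand |((y - 1 : ℤ) : ℝ)| x t -
      4 * potentialIntegrand |(y : ℝ)| x t = if y = 0 then 2 * Real.cos (x * t) else 0 := by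
  have hS : sinhDecay t ≠ 0 := by linarith [(sinhDecay_bounds h0.le h1).1]
  have hE := exp_neg_abs_mul_add y (latticeDecay t)
  rw [exp_add_exp_neg_latticeDecay, exp_sub_exp_neg_latticeDecay] at hE
  have hc : Real.cos ((x + 1 : ℤ) * t) + Real.cos ((x - 1 : ℤ) * t) =
      2 * Real.cos (x * t) * Real.cos t := by
    push_cast
    rw [add_mul, sub_mul, one_mul, Real.cos_add, Real.cos_sub]; ring
  simp only [potentialIntegrand]
  rw [mul_div_assoc', ← add_div, ← add_div, ← add_div, ← sub_div, div_eq_iff hS]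
  split_ifs at hE ⊢ with h
  · subst h
    simp only [Int.cast_zero, abs_zero, zero_mul, neg_zero, Real.exp_zero, one_mul] at hE ⊢
    linear_combination (-Real.cos (x * t)) * hE - hc
  · linear_combination (-Real.cos (x * t)) * hE - Real.exp (-(|(y : ℝ)| * latticeDecay t)) * hc

theorem integral_cos_int_mul (x : ℤ) :
    ∫ t in (0 : ℝ)..Real.pi, 2 * Real.cos (x * t) = if x = 0 then 2 * Real.pi else 0 := by
  split_ifs with h
  · subst h; simp [mul_comm]
  · have hx : (x : ℝ) ≠ 0 := by exact_mod_cast h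
    rw [intervalIntegral.integral_const_mul, intervalIntegral.integral_comp_mul_left _ hx]
    simp [Real.sin_int_mul_pi]

theorem latticeLaplacian_potentialKernel (x : ℤ × ℤ) :
    latticeLaplacian potentialKernel x = if x = 0 then 4 else 0 := by
  obtain ⟨x, y⟩ := x
  have hi : ∀ a b : ℤ, IntervalIntegrable (potentialIntegrand |(a : ℝ)| b)
      MeasureTheory.volume 0 Real.pi := fun a b =>
    intervalIntegrable_potentialIntegrand (abs_nonneg _) _
  have e : latticeLaplacian potentialKernel (x, y) = 2 / Real.pi * ∫ t in (0 : ℝ)..Real.pi,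
      (potentialIntegrand |(y : ℝ)| (x + 1 : ℤ) t + potentialIntegrand |(y : ℝ)| (x - 1 : ℤ) t +
      potentialIntegrand |((y + 1 : ℤ) : ℝ)| x t + potentialIntegrand |((y - 1 : ℤ) : ℝ)| x t -
      4 * potentialIntegrand |(y : ℝ)| x t) := by
    rw [intervalIntegral.integral_sub ((((hi _ _).add (hi _ _)).add (hi _ _)).add (hi _ _))
      ((hi _ _).const_mul 4), intervalIntegral.integral_add (((hi _ _).add (hi _ _)).add (hi _ _))
      (hi _ _), intervalIntegral.integral_add ((hi _ _).add (hi _ _)) (hi _ _),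
      intervalIntegral.integral_add (hi _ _) (hi _ _), intervalIntegral.integral_const_mul]
    simp only [latticeLaplacian, potentialKernel]
    ring
  have e2 : ∫ t in (0 : ℝ)..Real.pi,
      (potentialIntegrand |(y : ℝ)| (x + 1 : ℤ) t + potentialIntegrand |(y : ℝ)| (x - 1 : ℤ) t +
      potentialIntegrand |((y + 1 : ℤ) : ℝ)| x t + potentialIntegrand |((y - 1 : ℤ) : ℝ)| x t -
      4 * potentialIntegrand |(y : ℝ)| x t) =
      ∫ t in (0 : ℝ)..Real.pi, if y = 0 then 2 * Real.cos (x * t) else 0 := by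
    refine intervalIntegral.integral_congr_ae (Eventually.of_forall fun t ht => ?_)
    rw [Set.uIoc_of_le Real.pi_pos.le] at ht
    exact potentialIntegrand_laplacian x y ht.1 ht.2
  rw [e, e2]
  have hpi := Real.pi_pos.ne'
  by_cases hy : y = 0
  · simp only [hy, if_true, integral_cos_int_mul]
    by_cases hx : x = 0
    · simp only [hx, if_true]
      rw [if_pos (by rfl)]
      field_simp; norm_num
    · simp [hx]
  · simp [hy]

theorem abs_potentialKernel_sub_le {x : ℤ × ℤ} {R : ℝ} (hR : 0 < R)
    (hRe : R ^ 2 = (x.1 : ℝ) ^ 2 + (x.2 : ℝ) ^ 2) :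
    |potentialKernel x - 2 / Real.pi * (Real.log R + kappa)| ≤ 109 / R := by
  have h := abs_integral_potentialIntegrand_sub_le (n := x.2.natAbs) (m := x.1.natAbs) hR (by
    rw [Nat.cast_natAbs, Nat.cast_natAbs, Int.cast_abs, Int.cast_abs, sq_abs, sq_abs, hRe]; ring)
  have e : (potentialIntegrand (x.2.natAbs : ℝ) (x.1.natAbs : ℝ)) =
      potentialIntegrand |(x.2 : ℝ)| x.1 := by
    ext t
    simp only [potentialIntegrand, Nat.cast_natAbs, Int.cast_abs]
    rcases abs_choice (x.1 : ℝ) with h | h <;> rw [h]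
    rw [neg_mul, Real.cos_neg]
  rw [e] at h
  have hpi := Real.pi_gt_three
  have h2 : 2 / Real.pi ≤ 1 := by rw [div_le_one Real.pi_pos]; linarith
  rw [potentialKernel, ← mul_sub, abs_mul, abs_of_pos (by positivity : 0 < 2 / Real.pi)]
  have : 0 ≤ 109 / R := by positivity
  calc _ ≤ 1 * (109 / R) := by gcongr
    _ = _ := one_mul _

/-! ### The maximum principle and the discrete Dirichlet problem. -/

theorem squareLattice_adj_iff (x y : ℤ × ℤ) : squareLattice.Adj x y ↔
    y = (x.1 + 1, x.2) ∨ y = (x.1 - 1, x.2) ∨ y = (x.1, x.2 + 1) ∨ y = (x.1, x.2 - 1) := by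
  obtain ⟨a, b⟩ := x
  obtain ⟨c, d⟩ := y
  simp only [squareLattice, Prod.mk.injEq]
  rcases abs_cases (a - c) with ⟨h, _⟩ | ⟨h, _⟩ <;> rcases abs_cases (b - d) with ⟨h', _⟩ | ⟨h', _⟩
    <;> rw [h, h'] <;> omega

/-- The discrete maximum principle on a finite set. -/
theorem le_of_latticeLaplacian_nonneg {B : Set (ℤ × ℤ)} (hB : B.Finite) {f : ℤ × ℤ → ℝ} {M : ℝ}
    (hf : ∀ x ∈ B, 0 ≤ latticeLaplacian f x)
    (hM : ∀ x ∈ B, ∀ y ∉ B, squareLattice.Adj x y → f y ≤ M) : ∀ x ∈ B, f x ≤ M := by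
  intro x₀ hx₀
  -- Among the maximizers take one with largest first coordinate. Its right neighbour is then
  -- strictly smaller, forcing a negative Laplacian with no connectedness argument.
  obtain ⟨x, hx, hmax⟩ := Set.exists_max_image B (fun x => toLex (f x, x.1)) hB ⟨x₀, hx₀⟩
  have hle : ∀ y ∈ B, f y < f x ∨ f y = f x ∧ y.1 ≤ x.1 := fun y hy => by
    simpa [Prod.Lex.le_iff] using hmax y hy
  have hle' : ∀ y ∈ B, f y ≤ f x := fun y hy => (hle y hy).elim le_of_lt fun h => h.1.le
  refine (hle' x₀ hx₀).trans ?_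
  by_contra! hlt
  have hnb : ∀ y, squareLattice.Adj x y → f y ≤ f x := fun y hy => by
    by_cases hyB : y ∈ B
    · exact hle' y hyB
    · exact (hM x hx y hyB hy).trans hlt.le
  have h1 : f (x.1 + 1, x.2) < f x := by
    by_cases hyB : (x.1 + 1, x.2) ∈ B
    · rcases hle _ hyB with h | ⟨_, h⟩
      · exact h
      · simp at h
    · exact (hM x hx _ hyB ((squareLattice_adj_iff _ _).2 (by simp))).trans_lt hlt
  have h2 := hnb (x.1 - 1, x.2) ((squareLattice_adj_iff _ _).2 (by simp))
  have h3 := hnb (x.1, x.2 + 1) ((squareLattice_adj_iff _ _).2 (by simp))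
  have h4 := hnb (x.1, x.2 - 1) ((squareLattice_adj_iff _ _).2 (by simp))
  have h5 := hf x hx
  rw [latticeLaplacian] at h5
  linarith

/-- `latticeLaplacian` as a linear map. -/
def latticeLaplacianₗ : (ℤ × ℤ → ℝ) →ₗ[ℝ] (ℤ × ℤ → ℝ) where
  toFun := latticeLaplacian
  map_add' f g := by ext x; simp only [latticeLaplacian, Pi.add_apply]; ring
  map_smul' c f := by
    ext x; simp only [latticeLaplacian, Pi.smul_apply, smul_eq_mul, RingHom.id_apply]; ring

/-- Solvability of the discrete Dirichlet problem on a finite set. -/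
theorem exists_latticeLaplacian_eq {B : Set (ℤ × ℤ)} (hB : B.Finite) (g : ℤ × ℤ → ℝ) :
    ∃ p : ℤ × ℤ → ℝ, (∀ x ∉ B, p x = 0) ∧ ∀ x ∈ B, latticeLaplacian p x = g x := by
  have := hB.fintype
  let T : (B → ℝ) →ₗ[ℝ] (B → ℝ) := LinearMap.funLeft ℝ ℝ Subtype.val ∘ₗ latticeLaplacianₗ ∘ₗ
    Function.ExtendByZero.linearMap ℝ (Subtype.val : B → ℤ × ℤ)
  have hoff : ∀ (f : B → ℝ), ∀ x ∉ B, Function.extend Subtype.val f 0 x = 0 := fun f x hx => by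
    rw [Function.extend_apply' _ _ _ (by rintro ⟨y, rfl⟩; exact hx y.2)]; rfl
  have hT : ∀ (f : B → ℝ) (x : B), T f x =
      latticeLaplacian (Function.extend Subtype.val f 0) x := fun f x => rfl
  have hle : ∀ f : B → ℝ, T f = 0 → ∀ x, f x ≤ 0 := fun f hf x => by
    have := le_of_latticeLaplacian_nonneg hB (f := Function.extend Subtype.val f 0) (M := 0)
      (fun y hy => by
        have := congrFun hf ⟨y, hy⟩
        rw [hT] at this
        exact this.ge)
      (fun _ _ y hy _ => (hoff f y hy).le) x x.2
    rwa [Subtype.val_injective.extend_apply] at this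
  -- The maximum principle for `f` and `-f` gives injectivity, hence surjectivity in finite
  -- dimension.
  have hinj : Function.Injective T := by
    rw [← LinearMap.ker_eq_bot, LinearMap.ker_eq_bot']
    intro f hf
    ext x
    refine le_antisymm (hle f hf x) ?_
    have := hle (-f) (by rw [map_neg, hf, neg_zero]) x
    simpa using this
  obtain ⟨f, hf⟩ := LinearMap.injective_iff_surjective.1 hinj fun x => g x
  refine ⟨Function.extend Subtype.val f 0, hoff f, fun x hx => ?_⟩
  have := congrFun hf ⟨x, hx⟩
  rwa [hT] at this

/-! ### Summation by parts and the Dirichlet energy. -/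

theorem finsum_sub_mul_sub_shift {φ : ℤ × ℤ → ℝ} (hφ : φ.support.Finite) (ψ : ℤ × ℤ → ℝ)
    (e : ℤ × ℤ) :
    ∑ᶠ x, (φ (x + e) - φ x) * (ψ (x + e) - ψ x) =
      ∑ᶠ x, φ x * (2 * ψ x - ψ (x + e) - ψ (x - e)) := by
  have hmul : ∀ g : ℤ × ℤ → ℝ, (Function.support fun x => φ x * g x).Finite := fun g =>
    hφ.subset (Function.support_mul_subset_left _ _)
  have hshift : (Function.support fun x => φ (x + e) * (ψ (x + e) - ψ x)).Finite := by
    have := (hmul fun x => ψ x - ψ (x - e)).preimage (Equiv.addRight e).injective.injOn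
    refine this.subset fun x hx => ?_
    simpa using hx
  have h1 : ∑ᶠ x, φ (x + e) * (ψ (x + e) - ψ x) = ∑ᶠ x, φ x * (ψ x - ψ (x - e)) := by
    rw [← finsum_comp_equiv (Equiv.addRight e) (f := fun x => φ x * (ψ x - ψ (x - e)))]
    simp
  calc _ = ∑ᶠ x, (φ (x + e) * (ψ (x + e) - ψ x) - φ x * (ψ (x + e) - ψ x)) := by
        congr 1; ext x; ring
    _ = ∑ᶠ x, (φ x * (ψ x - ψ (x - e)) - φ x * (ψ (x + e) - ψ x)) := by
        rw [finsum_sub_distrib hshift (hmul _), h1, ← finsum_sub_distrib (hmul _) (hmul _)]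
    _ = _ := by congr 1; ext x; ring

/-- The gradient pairing over all bonds of the lattice. -/
noncomputable def gradientPairing (φ ψ : ℤ × ℤ → ℝ) : ℝ :=
  ∑ᶠ x, (φ (x + (1, 0)) - φ x) * (ψ (x + (1, 0)) - ψ x) +
    ∑ᶠ x, (φ (x + (0, 1)) - φ x) * (ψ (x + (0, 1)) - ψ x)

theorem gradientPairing_comm (φ ψ : ℤ × ℤ → ℝ) : gradientPairing φ ψ = gradientPairing ψ φ := by
  simp only [gradientPairing, mul_comm]

theorem gradientPairing_self_nonneg (φ : ℤ × ℤ → ℝ) : 0 ≤ gradientPairing φ φ :=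
  add_nonneg (finsum_nonneg fun _ => mul_self_nonneg _) (finsum_nonneg fun _ => mul_self_nonneg _)

theorem gradientPairing_eq_sum {B : Finset (ℤ × ℤ)} {φ : ℤ × ℤ → ℝ} (hφ : ∀ x ∉ B, φ x = 0)
    (ψ : ℤ × ℤ → ℝ) : gradientPairing φ ψ = -∑ x ∈ B, φ x * latticeLaplacian ψ x := by
  have hsub : φ.support ⊆ B := fun x hx => by
    by_contra h
    exact hx (hφ x h)
  have hfin : φ.support.Finite := B.finite_toSet.subset hsub
  have hmul : ∀ g : ℤ × ℤ → ℝ, ∑ᶠ x, φ x * g x = ∑ x ∈ B, φ x * g x := fun g =>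
    finsum_eq_sum_of_support_subset _ ((Function.support_mul_subset_left _ _).trans hsub)
  rw [gradientPairing, finsum_sub_mul_sub_shift hfin, finsum_sub_mul_sub_shift hfin, hmul, hmul,
    ← Finset.sum_add_distrib, ← Finset.sum_neg_distrib]
  refine Finset.sum_congr rfl fun x _ => ?_
  obtain ⟨a, b⟩ := x
  simp only [latticeLaplacian, Prod.mk_add_mk, Prod.mk_sub_mk, add_zero, sub_zero]
  ring

theorem squareLattice_edgeSet_eq : squareLattice.edgeSet =
    Set.range (fun x : ℤ × ℤ => s(x, x + (1, 0))) ∪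
      Set.range (fun x : ℤ × ℤ => s(x, x + (0, 1))) := by
  ext e
  induction e using Sym2.ind with
  | _ x y =>
    obtain ⟨a, b⟩ := x
    obtain ⟨c, d⟩ := y
    simp only [SimpleGraph.mem_edgeSet, squareLattice_adj_iff, Set.mem_union, Set.mem_range,
      Sym2.eq_iff, Prod.mk.injEq, Prod.exists, Prod.mk_add_mk, add_zero]
    constructor
    · rintro (⟨h, h'⟩ | ⟨h, h'⟩ | ⟨h, h'⟩ | ⟨h, h'⟩)
      · exact Or.inl ⟨a, b, by simp [h, h']⟩
      · exact Or.inl ⟨a - 1, b, by simp [h, h']⟩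
      · exact Or.inr ⟨a, b, by simp [h, h']⟩
      · exact Or.inr ⟨a, b - 1, by simp [h, h']⟩
    · rintro (⟨u, v, h⟩ | ⟨u, v, h⟩) <;> omega

/-- Bonds not meeting the ball carry no energy, so the sum extends to all bonds, each listed once by
its left or lower endpoint. -/
theorem dirichletEnergy_eq_gradientPairing {r : ℝ} {φ : ℤ × ℤ → ℝ}
    (hφ : ∀ x ∉ discreteBall r, φ x = 0) : dirichletEnergy r φ = gradientPairing φ φ := by
  have hzero : squareLattice.edgeSet ∩ Function.support (bondEnergy φ) ⊆ incidentBonds r := by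
    rintro e ⟨he, hne⟩
    refine ⟨he, ?_⟩
    by_contra! h
    induction e using Sym2.ind with
    | _ x y =>
      apply hne
      simp [bondEnergy, hφ x (h x (by simp)), hφ y (h y (by simp))]
  have h1 : dirichletEnergy r φ = ∑ᶠ e ∈ squareLattice.edgeSet, bondEnergy φ e :=
    finsum_mem_inter_support_eq _ _ _ (Set.Subset.antisymm
      (fun e he => ⟨he.1.1, he.2⟩) fun e he => ⟨hzero he, he.2⟩)
  have hfin := (incidentBonds_finite r).subset hzero
  rw [squareLattice_edgeSet_eq, Set.union_inter_distrib_right] at hfin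
  rw [h1, squareLattice_edgeSet_eq, finsum_mem_union' ?_ (hfin.subset Set.subset_union_left)
    (hfin.subset Set.subset_union_right), finsum_mem_range, finsum_mem_range, gradientPairing]
  · congr 2 <;> · ext x; simp only [bondEnergy, Sym2.lift_mk]; ring
  · rintro ⟨a, b⟩ ⟨c, d⟩ h
    simp only [Sym2.eq_iff, Prod.mk.injEq, Prod.mk_add_mk] at h ⊢
    omega
  · rintro ⟨a, b⟩ ⟨c, d⟩ h
    simp only [Sym2.eq_iff, Prod.mk.injEq, Prod.mk_add_mk] at h ⊢
    omega
  · rw [Set.disjoint_left]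
    rintro _ ⟨⟨a, b⟩, rfl⟩ ⟨⟨c, d⟩, h⟩
    simp only [Sym2.eq_iff, Prod.mk.injEq, Prod.mk_add_mk] at h
    omega

/-! ### The minimal energy and the Green function of the ball. -/

/-- The minimal Dirichlet energy in terms of the discrete Green function `p` of the ball. -/
theorem minDirichletEnergy_eq {r : ℝ} (hr : 0 < r) {p : ℤ × ℤ → ℝ}
    (hp0 : ∀ x ∉ discreteBall r, p x = 0)
    (hp : ∀ x ∈ discreteBall r, latticeLaplacian p x = if x = 0 then -4 else 0)
    (hpos : 0 < p 0) (h : ℝ) : minDirichletEnergy r h = 4 * h ^ 2 / p 0 := by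
  have h0B : (0 : ℤ × ℤ) ∈ discreteBall r := by simp [discreteBall, hr]
  set B := (discreteBall_finite r).toFinset with hB
  have hmem : ∀ x, x ∈ B ↔ x ∈ discreteBall r := fun x => by simp [hB]
  have hoff : ∀ φ : ℤ × ℤ → ℝ, (∀ x ∉ discreteBall r, φ x = 0) → ∀ x ∉ B, φ x = 0 :=
    fun φ hφ x hx => hφ x (by rwa [← hmem])
  have hpair : ∀ φ : ℤ × ℤ → ℝ, (∀ x ∉ discreteBall r, φ x = 0) →
      gradientPairing φ p = 4 * φ 0 := fun φ hφ => by
    rw [gradientPairing_eq_sum (hoff φ hφ), Finset.sum_eq_single_of_mem 0 ((hmem 0).2 h0B)]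
    · rw [hp 0 h0B, if_pos rfl]; ring
    · intro x hx hx0
      rw [hp x ((hmem x).1 hx), if_neg hx0, mul_zero]
  -- Expansion of the square, with cross terms known from `hpair`. For `c = h / p 0` its
  -- nonnegativity is the lower bound; equality holds at `φ = c • p`.
  have hsub : ∀ (φ : ℤ × ℤ → ℝ) (c : ℝ), (∀ x ∉ discreteBall r, φ x = 0) →
      gradientPairing (φ - c • p) (φ - c • p) =
        gradientPairing φ φ - 8 * c * φ 0 + 4 * c ^ 2 * p 0 := fun φ c hφ => by
    have e1 : gradientPairing p φ = 4 * φ 0 := by rw [gradientPairing_comm, hpair φ hφ]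
    have e2 := hpair φ hφ
    have e3 := hpair p hp0
    have hl : latticeLaplacian (φ - c • p) = latticeLaplacian φ - c • latticeLaplacian p := by
      have := latticeLaplacianₗ.map_sub φ (c • p)
      rwa [map_smul] at this
    rw [gradientPairing_eq_sum (hoff _ fun x hx => by simp [hφ x hx, hp0 x hx]), hl]
    rw [gradientPairing_eq_sum (hoff p hp0)] at e1 e3
    rw [gradientPairing_eq_sum (hoff φ hφ)] at e2
    rw [gradientPairing_eq_sum (hoff φ hφ)]
    have e4 : ∑ x ∈ B, (φ - c • p) x * (latticeLaplacian φ - c • latticeLaplacian p) x =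
        ∑ x ∈ B, φ x * latticeLaplacian φ x - c * ∑ x ∈ B, φ x * latticeLaplacian p x -
          c * ∑ x ∈ B, p x * latticeLaplacian φ x +
          c ^ 2 * ∑ x ∈ B, p x * latticeLaplacian p x := by
      simp only [Finset.mul_sum, ← Finset.sum_sub_distrib, ← Finset.sum_add_distrib]
      refine Finset.sum_congr rfl fun x _ => ?_
      simp only [Pi.sub_apply, Pi.smul_apply, smul_eq_mul]
      ring
    rw [e4]
    linear_combination c ^ 2 * e3 - c * e1 - c * e2
  have hleast : IsLeast {E | ∃ φ : ℤ × ℤ → ℝ, (∀ x, x ∉ discreteBall r → φ x = 0) ∧ φ 0 = h ∧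
      E = dirichletEnergy r φ} (4 * h ^ 2 / p 0) := by
    constructor
    · have hz : ∀ x ∉ discreteBall r, ((h / p 0) • p) x = 0 := fun x hx => by simp [hp0 x hx]
      refine ⟨(h / p 0) • p, hz, by simp [hpos.ne'], ?_⟩
      have := hsub 0 (-(h / p 0)) (fun _ _ => rfl)
      rw [dirichletEnergy_eq_gradientPairing hz]
      simp only [zero_sub, neg_smul, neg_neg, Pi.zero_apply, mul_zero, sub_zero] at this
      rw [this]
      have : gradientPairing 0 0 = 0 := by simp [gradientPairing]
      rw [this]
      field_simp
      ring
    · rintro _ ⟨φ, hφ, hh, rfl⟩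
      rw [dirichletEnergy_eq_gradientPairing hφ]
      have h1 := hsub φ (h / p 0) hφ
      have h2 := gradientPairing_self_nonneg (φ - (h / p 0) • p)
      rw [h1, hh] at h2
      have : 4 * h ^ 2 / p 0 = 8 * (h / p 0) * h - 4 * (h / p 0) ^ 2 * p 0 := by
        field_simp; ring
      linarith
  exact hleast.csInf_eq

/-- The potential kernel at lattice points just outside the ball. -/
theorem abs_potentialKernel_boundary_sub_le {r : ℝ} (hr : 0 < r) {x y : ℤ × ℤ}
    (hx : x ∈ discreteBall r) (hy : y ∉ discreteBall r) (hxy : squareLattice.Adj x y) :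
    |potentialKernel y - 2 / Real.pi * (Real.log r + kappa)| ≤ 110 / r := by
  simp only [discreteBall, Set.mem_ofPred_eq, not_lt] at hx hy
  set ρ := Real.sqrt ((x.1 : ℝ) ^ 2 + (x.2 : ℝ) ^ 2) with hρ
  set R := Real.sqrt ((y.1 : ℝ) ^ 2 + (y.2 : ℝ) ^ 2) with hR
  have hρ2 : ρ ^ 2 = (x.1 : ℝ) ^ 2 + (x.2 : ℝ) ^ 2 := Real.sq_sqrt (by positivity)
  have hR2 : R ^ 2 = (y.1 : ℝ) ^ 2 + (y.2 : ℝ) ^ 2 := Real.sq_sqrt (by positivity)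
  have hρ0 : 0 ≤ ρ := Real.sqrt_nonneg _
  have hx1 : |(x.1 : ℝ)| ≤ ρ := abs_le_of_sq_le_sq (by nlinarith [sq_nonneg (x.2 : ℝ)]) hρ0
  have hx2 : |(x.2 : ℝ)| ≤ ρ := abs_le_of_sq_le_sq (by nlinarith [sq_nonneg (x.1 : ℝ)]) hρ0
  rw [abs_le] at hx1 hx2
  have hRρ : R ≤ ρ + 1 := by
    refine abs_le_of_sq_le_sq' ?_ (by linarith) |>.2
    rw [hR2]
    rcases (squareLattice_adj_iff x y).1 hxy with h | h | h | h <;> rw [h] <;> push_cast <;>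
      nlinarith
  have hR0 : 0 < R := hr.trans_le hy
  have h1 := abs_potentialKernel_sub_le hR0 hR2
  have h2 : 0 ≤ Real.log R - Real.log r := sub_nonneg.2 (Real.log_le_log hr hy)
  -- Since `r ≤ R < r + 1`, replacing `log R` by `log r` costs at most `1/r`, which turns `109` into
  -- `110`.
  have h3 : Real.log R - Real.log r ≤ 1 / r := by
    rw [← Real.log_div hR0.ne' hr.ne']
    refine (Real.log_le_sub_one_of_pos (by positivity)).trans ?_
    rw [div_sub_one hr.ne']
    gcongr; linarith
  have h4 : 109 / R ≤ 109 / r := by gcongr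
  have hpi := Real.pi_gt_three
  have h5 : 2 / Real.pi ≤ 1 := by rw [div_le_one Real.pi_pos]; linarith
  have h6 : 0 < 2 / Real.pi := by positivity
  have h7 : 2 / Real.pi * (Real.log R - Real.log r) ≤ 1 / r := by nlinarith
  have h8 : 0 ≤ 2 / Real.pi * (Real.log R - Real.log r) := by positivity
  have h9 : 110 / r = 109 / r + 1 / r := by ring
  have h10 : 0 < 1 / r := by positivity
  rw [abs_le] at h1 ⊢
  rw [h9]
  constructor <;> linarith

/-- The Green function of the ball at the origin. -/
theorem exists_green_function {r : ℝ} (hr : 0 < r) : ∃ p : ℤ × ℤ → ℝ,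
    (∀ x ∉ discreteBall r, p x = 0) ∧
    (∀ x ∈ discreteBall r, latticeLaplacian p x = if x = 0 then -4 else 0) ∧ 1 ≤ p 0 ∧
    |p 0 - 2 / Real.pi * (Real.log r + kappa)| ≤ 110 / r := by
  have hB := discreteBall_finite r
  have h0B : (0 : ℤ × ℤ) ∈ discreteBall r := by simp [discreteBall, hr]
  obtain ⟨p, hp0, hp⟩ := exists_latticeLaplacian_eq hB fun x => if x = 0 then -4 else 0
  have hneg : ∀ f : ℤ × ℤ → ℝ, latticeLaplacian (-f) = -latticeLaplacian f :=
    latticeLaplacianₗ.map_neg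
  have hpnn : ∀ x, 0 ≤ p x := fun x => by
    by_cases hx : x ∈ discreteBall r
    · have := le_of_latticeLaplacian_nonneg hB (f := -p) (M := 0)
        (fun y hy => by
          rw [hneg, Pi.neg_apply, hp y hy]
          split_ifs <;> norm_num)
        (fun _ _ y hy _ => by simp [hp0 y hy]) x hx
      simpa using this
    · exact (hp0 x hx).ge
  refine ⟨p, hp0, hp, ?_, ?_⟩
  -- At the origin `4 p(0)` is `4` plus the sum of the nonnegative neighbouring values. This lower
  -- bound, uniform in `r`, keeps the later division by `p 0` harmless even for small `r`.
  · have h1 := hp 0 h0B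
    rw [if_pos rfl, latticeLaplacian] at h1
    linarith [hpnn ((0 : ℤ × ℤ).1 + 1, (0 : ℤ × ℤ).2), hpnn ((0 : ℤ × ℤ).1 - 1, (0 : ℤ × ℤ).2),
      hpnn ((0 : ℤ × ℤ).1, (0 : ℤ × ℤ).2 + 1), hpnn ((0 : ℤ × ℤ).1, (0 : ℤ × ℤ).2 - 1)]
  · have hadd : ∀ x ∈ discreteBall r, latticeLaplacian (p + potentialKernel) x = 0 := fun x hx => by
      rw [show latticeLaplacian (p + potentialKernel) = _ from
        latticeLaplacianₗ.map_add p potentialKernel]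
      change latticeLaplacian p x + latticeLaplacian potentialKernel x = 0
      rw [hp x hx, latticeLaplacian_potentialKernel]
      split_ifs <;> norm_num
    have hbd : ∀ x ∈ discreteBall r, ∀ y ∉ discreteBall r, squareLattice.Adj x y →
        |(p + potentialKernel) y - 2 / Real.pi * (Real.log r + kappa)| ≤ 110 / r :=
      fun x hx y hy hxy => by
        rw [Pi.add_apply, hp0 y hy, zero_add]
        exact abs_potentialKernel_boundary_sub_le hr hx hy hxy
    have h1 := le_of_latticeLaplacian_nonneg hB (fun x hx => (hadd x hx).ge)
      (M := 2 / Real.pi * (Real.log r + kappa) + 110 / r)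
      (fun x hx y hy hxy => by linarith [(abs_le.1 (hbd x hx y hy hxy)).2]) 0 h0B
    have h2 := le_of_latticeLaplacian_nonneg hB (f := -(p + potentialKernel))
      (fun x hx => by rw [hneg, Pi.neg_apply, hadd x hx, neg_zero])
      (M := -(2 / Real.pi * (Real.log r + kappa)) + 110 / r)
      (fun x hx y hy hxy => by
        rw [Pi.neg_apply]
        linarith [(abs_le.1 (hbd x hx y hy hxy)).1]) 0 h0B
    rw [Pi.neg_apply] at h2
    rw [Pi.add_apply, potentialKernel_zero, add_zero] at h1 h2
    rw [abs_le]
    constructor <;> linarith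

/-- Solve `4/p(0) = (2π + ε)/(log r + κ)` for `ε`. Then `880 = 2 · 4 · 110`, from `π ≤ 4`, the error
in `p(0)`, and `p(0) ≥ 1`. -/
theorem exists_minDirichletEnergy_eq {r : ℝ} (hr : 0 < r) (hl : Real.log r + kappa ≠ 0) :
    ∃ ε : ℝ, |ε| ≤ 880 / r ∧ ∀ h : ℝ, minDirichletEnergy r h =
      (2 * Real.pi + ε) * (h ^ 2 / (Real.log r + kappa)) := by
  obtain ⟨p, hp0, hp, h1, h2⟩ := exists_green_function hr
  have hpos : 0 < p 0 := by linarith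
  have hpi := Real.pi_pos
  refine ⟨4 * (Real.log r + kappa) / p 0 - 2 * Real.pi, ?_, fun h => ?_⟩
  · have e : 4 * (Real.log r + kappa) / p 0 - 2 * Real.pi =
        -(2 * Real.pi * (p 0 - 2 / Real.pi * (Real.log r + kappa))) / p 0 := by
      field_simp
      ring
    rw [e, abs_div, abs_neg, abs_mul, abs_of_pos hpos, abs_of_pos (by positivity : 0 < 2 * Real.pi),
      div_le_iff₀ hpos]
    calc _ ≤ 2 * 4 * (110 / r) := by
          gcongr
          exact Real.pi_le_four
      _ = 880 / r * 1 := by ring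
      _ ≤ 880 / r * p 0 := by gcongr
  · rw [minDirichletEnergy_eq hr hp0 hp hpos]
    field_simp
    ring

/-! ### The regime where `r` is of order `h / log h`. -/

theorem tendsto_id_div_log_atTop : Tendsto (fun h : ℝ => h / Real.log h) atTop atTop := by
  have h1 : Tendsto (fun h : ℝ => Real.log h / h) atTop (nhds 0) := by
    simpa using Real.isLittleO_log_id_atTop.tendsto_div_nhds_zero
  have h2 : Tendsto (fun h : ℝ => Real.log h / h) atTop (nhdsWithin 0 (Set.Ioi 0)) := by
    refine tendsto_nhdsWithin_iff.2 ⟨h1, ?_⟩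
    filter_upwards [eventually_gt_atTop 1] with h hh
    exact div_pos (Real.log_pos hh) (by linarith)
  refine h2.inv_tendsto_nhdsGT_zero.congr fun h => ?_
  simp

/-- If `r(h)` is of order `h / log h`, then `log r(h) + c ~ log h`. -/
theorem tendsto_log_add_const_div_log {r : ℝ → ℝ} {a b : ℝ} (ha : 0 < a)
    (hr : ∀ᶠ h in atTop, a * (h / Real.log h) ≤ r h ∧ r h ≤ b * (h / Real.log h)) (c : ℝ) :
    Tendsto (fun h => (Real.log (r h) + c) / Real.log h) atTop (nhds 1) := by
  have hlog := Real.tendsto_log_atTop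
  have hll : Tendsto (fun h : ℝ => Real.log (Real.log h) / Real.log h) atTop (nhds 0) := by
    have := (Real.isLittleO_log_id_atTop.tendsto_div_nhds_zero).comp hlog
    simpa [Function.comp_def] using this
  have hlim : ∀ d : ℝ, Tendsto (fun h : ℝ => d / Real.log h + 1 -
      Real.log (Real.log h) / Real.log h) atTop (nhds 1) := fun d => by
    have := ((hlog.const_div_atTop d).add_const 1).sub hll
    simpa using this
  -- Positivity of `b` is forced: the two bounds on `r h` are compatible for some `h > 1`.
  have hb : 0 < b := by
    obtain ⟨h, h1, h2⟩ := (hr.and (eventually_gt_atTop 1)).exists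
    have h3 : 0 < h / Real.log h := div_pos (by linarith) (Real.log_pos h2)
    have h4 : 0 < a * (h / Real.log h) := by positivity
    exact pos_of_mul_pos_left (h4.trans_le (h1.1.trans h1.2)) h3.le
  have heq : ∀ {d h : ℝ}, 0 < d → 1 < h → (Real.log (d * (h / Real.log h)) + c) / Real.log h =
      (Real.log d + c) / Real.log h + 1 - Real.log (Real.log h) / Real.log h :=
    fun {d h} hd hh => by
      have h3 := Real.log_pos hh
      have h0 : h ≠ 0 := by positivity
      rw [Real.log_mul hd.ne' (by positivity), Real.log_div h0 h3.ne']
      field_simp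
      ring
  refine tendsto_of_tendsto_of_tendsto_of_le_of_le' (hlim (Real.log a + c)) (hlim (Real.log b + c))
    ?_ ?_
  · filter_upwards [hr, eventually_gt_atTop 1] with h h1 h2
    have h3 := Real.log_pos h2
    rw [← heq ha h2]
    have : 0 < a * (h / Real.log h) := by positivity
    gcongr
    exact h1.1
  · filter_upwards [hr, eventually_gt_atTop 1] with h h1 h2
    have h3 := Real.log_pos h2
    rw [← heq hb h2]
    have : 0 < a * (h / Real.log h) := by positivity
    have := this.trans_le h1.1
    gcongr
    exact h1.2

theorem lemma2p2 :
    (∃ C : ℝ, ∀ r : ℝ, 0 < r → Real.log r + kappa ≠ 0 →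
      ∃ ε : ℝ, |ε| ≤ C / r ∧
        ∀ h : ℝ, minDirichletEnergy r h =
          (2 * Real.pi + ε) * (h ^ 2 / (Real.log r + kappa))) ∧
    (∀ r : ℝ → ℝ,
      (∃ a b : ℝ, 0 < a ∧ ∀ᶠ h in atTop,
        a * (h / Real.log h) ≤ r h ∧ r h ≤ b * (h / Real.log h)) →
      (fun h => minDirichletEnergy (r h) h) ~[atTop]
        (fun h => 2 * Real.pi * h ^ 2 / Real.log h)) := by
  refine ⟨⟨880, fun r hr hl => exists_minDirichletEnergy_eq hr hl⟩, ?_⟩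
  rintro r ⟨a, b, ha, hr⟩
  have hpi := Real.pi_pos
  have hrtop : Tendsto r atTop atTop :=
    tendsto_atTop_mono' _ (hr.mono fun _ h => h.1)
      (tendsto_id_div_log_atTop.const_mul_atTop ha)
  have hltop : Tendsto (fun h => Real.log (r h) + kappa) atTop atTop :=
    tendsto_atTop_add_const_right _ _ (Real.tendsto_log_atTop.comp hrtop)
  -- Solving for `ε` makes it an explicit function of `h`, so no choice of `ε` for each `h` is
  -- needed.
  have hε : Tendsto (fun h => minDirichletEnergy (r h) h * (Real.log (r h) + kappa) / h ^ 2 -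
      2 * Real.pi) atTop (nhds 0) := by
    refine squeeze_zero_norm' ?_ (hrtop.const_div_atTop 880)
    filter_upwards [hrtop.eventually_gt_atTop 0, hltop.eventually_gt_atTop 0,
      eventually_gt_atTop 0] with h h1 h2 h3
    obtain ⟨ε, hε, he⟩ := exists_minDirichletEnergy_eq h1 h2.ne'
    rw [he h, Real.norm_eq_abs]
    convert hε using 2
    field_simp
    ring
  rw [isEquivalent_iff_tendsto_one]
  · have h1 := ((hε.add_const (2 * Real.pi)).div_const (2 * Real.pi)).mul
      ((tendsto_log_add_const_div_log ha hr kappa).inv₀ one_ne_zero)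
    have e : (0 + 2 * Real.pi) / (2 * Real.pi) * (1 : ℝ)⁻¹ = 1 := by field_simp; ring
    rw [e] at h1
    refine h1.congr' ?_
    filter_upwards [hltop.eventually_gt_atTop 0, eventually_gt_atTop 1] with h h2 h3
    have h4 := Real.log_pos h3
    simp only [Pi.div_apply]
    field_simp
    ring
  · filter_upwards [eventually_gt_atTop 1] with h h3
    have h4 := Real.log_pos h3
    positivity
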